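/- Let $m\ge 0$, $s\ge 1$, $K\ge 0$ be integers and let $f:\mathbb{R}^m\times\mathbb{R}^m\to\mathbb{R}^m$ be of class $C^{2s}$. Let $y:[0,K]\to\mathbb{R}^m$ be a solution of $$\dot y(t)=f\bigl(y(t),y(\lfloor t\rfloor)\bigr),\qquad y(0)=y_0,$$ i.e. $y$ is continuous on $[0,K]$ and satisfies the equation on each interval $[k,k+1)\subseteq[0,K]$ with $k$ an integer (with the right derivative at $k$). For an integer $\nu\ge1$ put $h=1/\nu$, $N=K\nu$, $t_n=nh$ $(0\le n\le N)$. Let $P_j$ $(j\ge0)$ be the shifted Legendre polynomial of degree $j$, orthonormal in $L^2(0,1)$. A *piecewise polynomial approximation* of degree $s$ with step $h$ is a function $\sigma:[0,K]\to\mathbb{R}^m$ with $\sigma(0)=y_0$ such that for each $n=1,\dots,N$ the function $\sigma_n(x)=\sigma(t_{n-1}+x)$, $x\in[0,h]$, is a polynomial of degree at most $s$ and $$\dot\sigma_n(ch)=\sum_{j=0}^{s-1}P_j(c)\int_0^1P_j(\zeta)\,f\bigl(\sigma_n(\zeta h),\sigma(\lfloor t_{n-1}\rfloor)\bigr)\,d\zeta,\qquad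 c\in[0,1].$$ (This is the equation for $y$ with the local Legendre expansion of the right-hand side truncated to its first $s$ terms.) Let $\rho\in\mathbb{R}$. Then there is a constant $C$, depending only on $m,s,K,f,y_0,y,\rho$, such that for every $\nu\ge1$ and every such $\sigma$ with step $h=1/\nu$ whose variation inside each step is bounded by $\rho$, i.e. $$|\sigma_n(ch)-\sigma_n(0)|\le\rho\qquad\text{for all }n=1,\dots,N,\ c\in[0,1],$$ one has, for every $n=1,\dots,N$ (in particular also after the changes of the piecewise constant delay term), $$\bigl|\bigl(y(t_n)-\sigma(t_n)\bigr)-\bigl(y(t_{n-1})-\sigma(t_{n-1})\bigr)\bigr|\le C\,h^{2s+1},$$ $$|y(t_{n-1}+ch)-\sigma(t_{n-1}+ch)|\le C\,h^{s+1}\qquad\text{for all }c\in(0,1).$$ Here $|\cdot|$ is the Euclidean norm. -/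

import Mathlib

namespace FDEPCA

/-- The phase space `ℝᵐ`. -/
abbrev Vec (m : ℕ) : Type := EuclideanSpace ℝ (Fin m)

/-- A solution on `[0, K]` of `y'(t) = f (y t) (y ⌊t⌋)`, `y 0 = y₀`: a continuous function which
satisfies the equation on every interval `[k, k + 1)` contained in `[0, K]`
(at the left endpoint `k` the derivative is the right one). -/
structure IsSolution {m : ℕ} (f : Vec m → Vec m → Vec m) (y₀ : Vec m) (K : ℕ)
    (y : ℝ → Vec m) : Prop where
  continuousOn : ContinuousOn y (Set.Icc 0 (K : ℝ))
  initial : y 0 = y₀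
  equation : ∀ k : ℕ, k < K → ∀ t ∈ Set.Ico (k : ℝ) ((k : ℝ) + 1),
    HasDerivWithinAt y (f (y t) (y (⌊t⌋ : ℝ))) (Set.Ico (k : ℝ) ((k : ℝ) + 1)) t

/-- The step size `h = 1 / ν`. -/
noncomputable def step (ν : ℕ) : ℝ := 1 / (ν : ℝ)

/-- The mesh point `t_n = n h = n / ν`. -/
noncomputable def mesh (ν n : ℕ) : ℝ := (n : ℝ) / (ν : ℝ)

/-- The value at `x` of the `j`-th shifted Legendre polynomial, normalised to be orthonormal in
`L²(0, 1)` with positive leading coefficient. Mathlib's `shiftedLegendre` has leading coefficient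
of sign `(-1) ^ j` and squared `L²(0, 1)` norm `1 / (2 j + 1)`. -/
noncomputable def legendreP (j : ℕ) (x : ℝ) : ℝ :=
  Real.sqrt (2 * (j : ℝ) + 1) * ((-1) ^ j * Polynomial.aeval x (Polynomial.shiftedLegendre j))

/-- The Fourier coefficient `∫₀¹ P_j(ζ) f (z (ζ h)) φ dζ`, where `z` is a function on `[0, h]` and
`φ` is the value of the memory term. -/
noncomputable def legendreCoeff {m : ℕ} (f : Vec m → Vec m → Vec m) (h : ℝ) (j : ℕ)
    (z : ℝ → Vec m) (φ : Vec m) : Vec m :=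
  ∫ ζ in (0 : ℝ)..1, legendreP j ζ • f (z (ζ * h)) φ

/-- The restriction `σ_n(x) = σ(t_{n-1} + x)`, `x ∈ [0, h]`, of `σ` to the `n`-th step, `n ≥ 1`. -/
noncomputable def piece {m : ℕ} (ν : ℕ) (σ : ℝ → Vec m) (n : ℕ) : ℝ → Vec m :=
  fun x => σ (mesh ν (n - 1) + x)

/-- `σ` is a piecewise polynomial approximation of degree `s` on `[0, K]` with step `1 / ν`:
`σ 0 = y₀`, and on each of the `K ν` steps `[t_{n-1}, t_n]` it is a polynomial of degree at most
`s` which satisfies the equation obtained from `y'(t) = f (y t) (y ⌊t⌋)` by truncating the local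
Legendre expansion of the right-hand side to its first `s` terms. The memory term is the value of
`σ` at `⌊t_{n-1}⌋`. -/
structure IsPolyApprox {m : ℕ} (f : Vec m → Vec m → Vec m) (y₀ : Vec m) (s K ν : ℕ)
    (σ : ℝ → Vec m) : Prop where
  initial : σ 0 = y₀
  polynomial : ∀ n : ℕ, 1 ≤ n → n ≤ K * ν → ∃ a : ℕ → Vec m, ∀ c ∈ Set.Icc (0 : ℝ) 1,
    piece ν σ n (c * step ν) = ∑ i ∈ Finset.range (s + 1), c ^ i • a i
  equation : ∀ n : ℕ, 1 ≤ n → n ≤ K * ν → ∀ c ∈ Set.Icc (0 : ℝ) 1,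
    HasDerivWithinAt (piece ν σ n)
      (∑ j ∈ Finset.range s, legendreP j c •
        legendreCoeff f (step ν) j (piece ν σ n) (σ (⌊mesh ν (n - 1)⌋ : ℝ)))
      (Set.Icc 0 (step ν)) (c * step ν)

/-- Selection of the root of the (implicit) step equations: in no step does `σ` move further than
`ρ` away from its value at the beginning of that step. -/
def StepBounded {m : ℕ} (ρ : ℝ) (K ν : ℕ) (σ : ℝ → Vec m) : Prop :=
  ∀ n : ℕ, 1 ≤ n → n ≤ K * ν → ∀ c ∈ Set.Icc (0 : ℝ) 1,
    ‖piece ν σ n (c * step ν) - piece ν σ n 0‖ ≤ ρ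

end FDEPCA

/-!
Over one step, rescaled to `[0, 1]`, the exact solution `u` solves `u' = h F (u, φ)` and the
approximation `v` solves `v' = h Π F (v, ψ)`, where `Π` (`legendreProj`) is the truncated Legendre
expansion. As the functions `legendreP j` are orthonormal, `Π` reproduces the polynomials of degree
less than `s`, and the truncation error `δ = Π g - g` is orthogonal to them.

Smoothness that is uniform in the step size and in the approximation is expressed by `UniformJet`:
a family has a `k`-jet if it is, up to `O(h ^ k)`, a polynomial whose `j`-th coefficient is
`O(h ^ j)`. Jets are stable under products, integration, `Π` and composition with smooth functions,
so both right-hand sides and the linearisation `A` of `F` along `u` have `s`-jets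
(`UniformJet.bootstrap`); in particular `δ = O(h ^ s)`. With Grönwall's inequality this gives the
order `s + 1` inside a step.

The error `w = v - u` satisfies `w' = h (A w + ε + δ)`, where `ε` collects the quadratic remainder
and the error of the memory term. The change of `w` over the step is the integral of the right-hand
side. The integral of `δ` vanishes. The integral of `A w` is integrated by parts repeatedly, which
replaces the weight `A` by weights of size `h`, `h ^ 2`, …, until the bound `w = O(h ^ (s + 1))`
suffices; each time `δ` is integrated against an `s`-jet, which by orthogonality gives
`O(h ^ (2 * s))` (`exists_norm_integral_jet_apply_le`). This is a substitute for the nonlinear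
variation of constants formula which needs no fundamental solutions. Hence the error changes over
one step by `O(h)` times the error at the start of the step and at the memory point, plus
`O(h ^ (2 * s + 1))` (`StepFamily.exists_norm_increment_le`).

A discrete Grönwall inequality sums this up to a nodal error of `O(h ^ (2 * s))`. It is used twice:
first to keep the approximations in a fixed ball for all small `h`, as the constants of the one step
estimates depend on such a ball (`exists_norm_approx_le`), and then to obtain the orders.
-/

namespace FDEPCA

open MeasureTheory Set Polynomial

/-! ### Shifted Legendre polynomials and the truncated Legendre expansion -/

/-- The polynomial with values `legendreP j`. -/
noncomputable def legendrePoly (j : ℕ) : ℝ[X] :=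
  C (Real.sqrt (2 * (j : ℝ) + 1) * (-1) ^ j) * (shiftedLegendre j).map (Int.castRingHom ℝ)

theorem eval_legendrePoly (j : ℕ) (x : ℝ) : (legendrePoly j).eval x = legendreP j x := by
  simp only [legendrePoly, legendreP, eval_mul, eval_C, aeval_def, eval_map, mul_assoc]
  rfl

theorem continuous_legendreP (j : ℕ) : Continuous (legendreP j) := by
  simp only [← funext (eval_legendrePoly j)]
  exact (legendrePoly j).continuous

/-- Euler's beta integral at positive integers. -/
theorem integral_pow_mul_one_sub_pow (a b : ℕ) :
    ∫ x in (0 : ℝ)..1, x ^ a * (1 - x) ^ b = (a.factorial * b.factorial : ℝ) /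
      (a + b + 1).factorial := by
  induction b generalizing a with
  | zero =>
    simp only [pow_zero, mul_one, integral_pow]
    rw [add_zero, Nat.factorial_succ]
    have := Nat.factorial_ne_zero a
    push_cast
    field_simp
    simp
  | succ b ih =>
    have h := intervalIntegral.integral_eq_sub_of_hasDerivAt (a := 0) (b := 1)
      (f := fun x : ℝ => x ^ (a + 1) * (1 - x) ^ (b + 1))
      (f' := fun x => (a + 1) * (x ^ a * (1 - x) ^ (b + 1)) -
        (b + 1) * (x ^ (a + 1) * (1 - x) ^ b)) (fun x _ => by
          have := ((hasDerivAt_id' x).fun_pow (a + 1)).fun_mul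
            (((hasDerivAt_id' x).const_sub 1).fun_pow (b + 1))
          refine this.congr_deriv ?_
          push_cast
          ring) (by apply Continuous.intervalIntegrable; fun_prop)
    rw [intervalIntegral.integral_sub (by apply Continuous.intervalIntegrable; fun_prop)
      (by apply Continuous.intervalIntegrable; fun_prop),
      intervalIntegral.integral_const_mul, intervalIntegral.integral_const_mul, ih (a + 1)] at h
    simp only [one_pow, sub_self, ne_eq, Nat.add_eq_zero_iff, one_ne_zero, and_false,
      not_false_eq_true, zero_pow, mul_zero, sub_zero, zero_mul] at h
    have ha : (a + 1 : ℝ) ≠ 0 := by positivity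
    rw [← mul_right_inj' ha, sub_eq_zero.1 h, show a + 1 + b + 1 = a + (b + 1) + 1 by ring,
      Nat.factorial_succ a, Nat.factorial_succ b]
    push_cast
    ring

theorem integral_eval_mul_eval_derivative (p q : ℝ[X]) (h0 : q.eval 0 = 0) (h1 : q.eval 1 = 0) :
    ∫ x in (0 : ℝ)..1, p.eval x * (derivative q).eval x =
      -∫ x in (0 : ℝ)..1, (derivative p).eval x * q.eval x := by
  rw [intervalIntegral.integral_mul_deriv_eq_deriv_mul (fun x _ => p.hasDerivAt x)
    (fun x _ => q.hasDerivAt x) ((derivative p).continuous.intervalIntegrable _ _)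
    ((derivative q).continuous.intervalIntegrable _ _)]
  simp [h0, h1]

/-- The boundary terms in the integrations by parts vanish: `X ^ n * (1 - X) ^ n` has zeros of order
`n` at both endpoints. -/
theorem eval_iterate_derivative_weight (n k : ℕ) (hk : k < n) (x : ℝ) (hx : x = 0 ∨ x = 1) :
    (derivative^[k] (X ^ n * (1 - X : ℝ[X]) ^ n)).eval x = 0 := by
  rcases hx with rfl | rfl
  · have h := pow_sub_dvd_iterate_derivative_of_pow_dvd (p := (X ^ n * (1 - X : ℝ[X]) ^ n))
      (q := X) (n := n) k (dvd_mul_right _ _)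
    obtain ⟨r, hr⟩ := h
    rw [hr]
    simp [show n - k ≠ 0 by omega]
  · have h := pow_sub_dvd_iterate_derivative_of_pow_dvd (p := (X ^ n * (1 - X : ℝ[X]) ^ n))
      (q := 1 - X) (n := n) k (dvd_mul_left _ _)
    obtain ⟨r, hr⟩ := h
    rw [hr]
    simp [show n - k ≠ 0 by omega]

theorem integral_eval_mul_iterate_derivative_weight (n k : ℕ) (hk : k ≤ n) (p : ℝ[X]) :
    ∫ x in (0 : ℝ)..1, p.eval x * (derivative^[k] (X ^ n * (1 - X : ℝ[X]) ^ n)).eval x =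
      (-1) ^ k * ∫ x in (0 : ℝ)..1,
        (derivative^[k] p).eval x * (X ^ n * (1 - X : ℝ[X]) ^ n).eval x := by
  induction k generalizing p with
  | zero => simp
  | succ k ih =>
    rw [Function.iterate_succ_apply', integral_eval_mul_eval_derivative _ _
      (eval_iterate_derivative_weight n k hk 0 (Or.inl rfl))
      (eval_iterate_derivative_weight n k hk 1 (Or.inr rfl)), ih (by omega),
      Function.iterate_succ_apply, pow_succ]
    ring

theorem factorial_mul_map_shiftedLegendre (n : ℕ) :
    (n.factorial : ℝ[X]) * (shiftedLegendre n).map (Int.castRingHom ℝ) =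
      derivative^[n] (X ^ n * (1 - X : ℝ[X]) ^ n) := by
  have h := congrArg (Polynomial.map (Int.castRingHom ℝ)) (factorial_mul_shiftedLegendre_eq n)
  rw [← iterate_derivative_map] at h
  simpa using h

/-- Rodrigues' formula and `n` integrations by parts. -/
theorem integral_eval_mul_shiftedLegendre (n : ℕ) (p : ℝ[X]) :
    n.factorial * ∫ x in (0 : ℝ)..1,
        p.eval x * ((shiftedLegendre n).map (Int.castRingHom ℝ)).eval x =
      (-1) ^ n * ∫ x in (0 : ℝ)..1, (derivative^[n] p).eval x * (x ^ n * (1 - x) ^ n) := by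
  rw [← intervalIntegral.integral_const_mul]
  have := integral_eval_mul_iterate_derivative_weight n n le_rfl p
  rw [← factorial_mul_map_shiftedLegendre] at this
  simp only [eval_mul, eval_natCast, eval_pow, eval_X, eval_sub, eval_one] at this
  rw [← this]
  congr 1
  ext x
  ring

theorem degree_legendrePoly (j : ℕ) : (legendrePoly j).degree = j := by
  rw [legendrePoly, degree_C_mul, degree_map_eq_of_injective (Int.cast_injective),
    degree_shiftedLegendre]
  have : (0 : ℝ) < 2 * j + 1 := by positivity
  have := Real.sqrt_pos.2 this
  exact mul_ne_zero this.ne' (pow_ne_zero _ (by norm_num))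

theorem integral_legendrePoly_mul_of_degree_lt (j : ℕ) (p : ℝ[X]) (hp : p.degree < j) :
    ∫ x in (0 : ℝ)..1, p.eval x * (legendrePoly j).eval x = 0 := by
  have h := integral_eval_mul_shiftedLegendre j p
  rw [iterate_derivative_eq_zero_of_degree_lt hp] at h
  have hj : (j.factorial : ℝ) ≠ 0 := by exact_mod_cast Nat.factorial_ne_zero j
  simp only [eval_zero, zero_mul, intervalIntegral.integral_zero, mul_zero, mul_eq_zero, hj,
    false_or] at h
  simp only [legendrePoly, eval_mul, eval_C, mul_left_comm (p.eval _) (_ * _),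
    intervalIntegral.integral_const_mul, h, mul_zero]

theorem integral_shiftedLegendre_sq (n : ℕ) :
    ∫ x in (0 : ℝ)..1, ((shiftedLegendre n).map (Int.castRingHom ℝ)).eval x *
      ((shiftedLegendre n).map (Int.castRingHom ℝ)).eval x = 1 / (2 * n + 1) := by
  have h := integral_eval_mul_shiftedLegendre n ((shiftedLegendre n).map (Int.castRingHom ℝ))
  -- The `n`-th derivative is the constant `n! * (-1) ^ n * choose (2 n) n`.
  have hd : derivative^[n] ((shiftedLegendre n).map (Int.castRingHom ℝ)) =
      C ((n.factorial : ℝ) * ((-1) ^ n * (n + n).choose n)) := by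
    rw [eq_C_of_natDegree_eq_zero (p := derivative^[n] _)]
    · rw [coeff_iterate_derivative]
      simp [coeff_shiftedLegendre, Nat.descFactorial_self]
    · have := natDegree_iterate_derivative ((shiftedLegendre n).map (Int.castRingHom ℝ)) n
      have h2 := natDegree_map_le (f := Int.castRingHom ℝ) (p := shiftedLegendre n)
      simp only [natDegree_shiftedLegendre] at h2
      omega
  simp only [hd, eval_C, intervalIntegral.integral_const_mul,
    integral_pow_mul_one_sub_pow] at h
  have hc : ((n + n).choose n : ℝ) * n.factorial * n.factorial = (n + n).factorial := by
    have := Nat.choose_mul_factorial_mul_factorial (n := n + n) (k := n) (by omega)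
    rw [Nat.add_sub_cancel] at this
    exact_mod_cast this
  have hj : (n.factorial : ℝ) ≠ 0 := by exact_mod_cast Nat.factorial_ne_zero n
  have hs : ((-1 : ℝ) ^ n) * (-1) ^ n = 1 := by rw [← mul_pow]; simp
  have hk : ((n + n).factorial : ℝ) ≠ 0 := by exact_mod_cast Nat.factorial_ne_zero _
  rw [← mul_right_inj' hj, h, Nat.factorial_succ, Nat.cast_mul, ← hc]
  rw [← hc] at hk
  have h2 : (2 * n + 1 : ℝ) ≠ 0 := by positivity
  push_cast
  rw [← two_mul]
  generalize hA : ((2 * n).choose n : ℝ) = A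
  rw [← two_mul, hA] at hk
  have hA0 : A ≠ 0 := fun h => hk (by simp [h])
  field_simp
  linear_combination (2 * (n : ℝ) + 1) * hs

/-- The functions `legendreP j` are orthonormal in `L²(0, 1)`. -/
theorem integral_legendrePoly_mul (i j : ℕ) :
    ∫ x in (0 : ℝ)..1, (legendrePoly i).eval x * (legendrePoly j).eval x =
      if i = j then 1 else 0 := by
  rcases lt_trichotomy i j with h | rfl | h
  · rw [if_neg h.ne]
    exact integral_legendrePoly_mul_of_degree_lt j _ (by
      rw [degree_legendrePoly]; exact_mod_cast h)
  · simp only [if_true, legendrePoly, eval_mul, eval_C]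
    simp only [mul_mul_mul_comm _ (eval _ _), intervalIntegral.integral_const_mul]
    rw [integral_shiftedLegendre_sq]
    have h0 : (0 : ℝ) ≤ 2 * i + 1 := by positivity
    have h1 : (2 * i + 1 : ℝ) ≠ 0 := by positivity
    rw [mul_mul_mul_comm, Real.mul_self_sqrt h0, ← mul_pow]
    field_simp
    simp
  · rw [if_neg h.ne']
    simp only [mul_comm ((legendrePoly i).eval _)]
    exact integral_legendrePoly_mul_of_degree_lt i _ (by
      rw [degree_legendrePoly]; exact_mod_cast h)

theorem exists_eq_sum_legendrePoly (s : ℕ) (p : ℝ[X]) (hp : p.degree < s) :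
    ∃ b : ℕ → ℝ, p = ∑ j ∈ Finset.range s, C (b j) * legendrePoly j := by
  induction s generalizing p with
  | zero =>
    refine ⟨0, ?_⟩
    simpa [degree_lt_iff_coeff_zero, Polynomial.ext_iff] using hp
  | succ s ih =>
    have hq : (legendrePoly s).coeff s ≠ 0 :=
      coeff_ne_zero_of_eq_degree (degree_legendrePoly s)
    set t := p.coeff s / (legendrePoly s).coeff s with ht
    obtain ⟨b, hb⟩ := ih (p - C t * legendrePoly s) (by
      rw [degree_lt_iff_coeff_zero]
      intro k hk
      rcases hk.eq_or_lt with rfl | hk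
      · simp [ht, hq]
      · rw [coeff_sub, coeff_C_mul, coeff_eq_zero_of_degree_lt (hp.trans_le (by exact_mod_cast hk)),
          coeff_eq_zero_of_degree_lt (by rw [degree_legendrePoly]; exact_mod_cast hk)]
        simp)
    refine ⟨Function.update b s t, ?_⟩
    rw [Finset.sum_range_succ, Function.update_self, ← sub_eq_iff_eq_add, hb]
    refine Finset.sum_congr rfl fun j hj => ?_
    rw [Function.update_of_ne (Finset.mem_range.1 hj).ne]

theorem exists_pow_eq_sum_legendreP (s i : ℕ) (hi : i < s) :
    ∃ b : ℕ → ℝ, ∀ c : ℝ, c ^ i = ∑ j ∈ Finset.range s, b j * legendreP j c := by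
  obtain ⟨b, hb⟩ := exists_eq_sum_legendrePoly s (X ^ i) (by
    rw [degree_X_pow]; exact_mod_cast hi)
  refine ⟨b, fun c => ?_⟩
  have := congrArg (Polynomial.eval c) hb
  simpa [eval_finsetSum, eval_legendrePoly] using this

theorem integral_legendreP_mul (i j : ℕ) :
    ∫ x in (0 : ℝ)..1, legendreP i x * legendreP j x = if i = j then 1 else 0 := by
  simp only [← integral_legendrePoly_mul, eval_legendrePoly]

variable {E : Type*} [NormedAddCommGroup E] [NormedSpace ℝ E]

/-- The Legendre expansion on `[0, 1]`, truncated to its first `s` terms: the orthogonal projection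
of `L²(0, 1)` onto the polynomials of degree less than `s`. -/
noncomputable def legendreProj (s : ℕ) (g : ℝ → E) (c : ℝ) : E :=
  ∑ j ∈ Finset.range s, legendreP j c • ∫ ζ in (0 : ℝ)..1, legendreP j ζ • g ζ

theorem continuous_legendreProj (s : ℕ) (g : ℝ → E) : Continuous (legendreProj s g) :=
  continuous_finsetSum _ fun j _ => (continuous_legendreP j).smul continuous_const

theorem intervalIntegrable_smul_of_continuousOn {p : ℝ → ℝ} (hp : Continuous p) {g : ℝ → E}
    (hg : ContinuousOn g (Icc 0 1)) :
    IntervalIntegrable (fun x => p x • g x) volume 0 1 :=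
  ContinuousOn.intervalIntegrable_of_Icc zero_le_one (hp.continuousOn.smul hg)

theorem legendreProj_add (s : ℕ) {g₁ g₂ : ℝ → E} (h₁ : ContinuousOn g₁ (Icc 0 1))
    (h₂ : ContinuousOn g₂ (Icc 0 1)) (c : ℝ) :
    legendreProj s (fun x => g₁ x + g₂ x) c = legendreProj s g₁ c + legendreProj s g₂ c := by
  simp only [legendreProj, ← Finset.sum_add_distrib, ← smul_add]
  refine Finset.sum_congr rfl fun j _ => ?_
  rw [← intervalIntegral.integral_add
    (intervalIntegrable_smul_of_continuousOn (continuous_legendreP j) h₁)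
    (intervalIntegrable_smul_of_continuousOn (continuous_legendreP j) h₂)]
  simp only [smul_add]

theorem legendreProj_finsetSum (s : ℕ) {J : Type*} (t : Finset J) {g : J → ℝ → E}
    (hg : ∀ j ∈ t, Continuous (g j)) (c : ℝ) :
    legendreProj s (fun x => ∑ j ∈ t, g j x) c = ∑ j ∈ t, legendreProj s (g j) c := by
  classical
  induction t using Finset.induction_on with
  | empty => simp [legendreProj]
  | insert j t hj ih =>
    have ht : ∀ k ∈ t, Continuous (g k) := fun k hk => hg k (Finset.mem_insert_of_mem hk)
    simp only [Finset.sum_insert hj]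
    rw [legendreProj_add s (hg j (Finset.mem_insert_self _ _)).continuousOn
      (continuous_finsetSum t ht).continuousOn, ih ht]

theorem legendreProj_congr (s : ℕ) {g₁ g₂ : ℝ → E} (h : EqOn g₁ g₂ (Icc 0 1)) (c : ℝ) :
    legendreProj s g₁ c = legendreProj s g₂ c := by
  refine Finset.sum_congr rfl fun j _ => ?_
  congr 1
  refine intervalIntegral.integral_congr fun x hx => ?_
  rw [uIcc_of_le zero_le_one] at hx
  simp only [h hx]

theorem exists_norm_legendreP_le (s : ℕ) :
    ∃ L : ℝ, 0 ≤ L ∧ ∀ j < s, ∀ c ∈ Icc (0 : ℝ) 1, |legendreP j c| ≤ L := by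
  have h : ∀ j, ∃ L : ℝ, ∀ c ∈ Icc (0 : ℝ) 1, |legendreP j c| ≤ L := fun j =>
    isCompact_Icc.exists_bound_of_continuousOn (continuous_legendreP j).continuousOn
  choose L hL using h
  have h0 : ∀ j, 0 ≤ L j := fun j => (abs_nonneg _).trans (hL j 0 ⟨le_rfl, zero_le_one⟩)
  exact ⟨∑ j ∈ Finset.range s, L j, Finset.sum_nonneg fun j _ => h0 j, fun j hj c hc =>
    (hL j c hc).trans (Finset.single_le_sum (f := L) (fun j _ => h0 j) (Finset.mem_range.2 hj))⟩

/-- Truncation of the Legendre expansion is bounded for the supremum norm. -/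
theorem exists_norm_legendreProj_le (s : ℕ) :
    ∃ L : ℝ, 0 ≤ L ∧ ∀ (g : ℝ → E) (M : ℝ), (∀ x ∈ Icc (0 : ℝ) 1, ‖g x‖ ≤ M) →
      ∀ c ∈ Icc (0 : ℝ) 1, ‖legendreProj s g c‖ ≤ L * M := by
  obtain ⟨L, hL0, hL⟩ := exists_norm_legendreP_le s
  refine ⟨s * (L * L), by positivity, fun g M hM c hc => ?_⟩
  have : ∀ j ∈ Finset.range s,
      ‖legendreP j c • ∫ ζ in (0 : ℝ)..1, legendreP j ζ • g ζ‖ ≤ L * (L * M) := by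
    intro j hj
    have hj := Finset.mem_range.1 hj
    rw [norm_smul]
    refine mul_le_mul (hL j hj c hc) ?_ (norm_nonneg _) hL0
    refine (intervalIntegral.norm_integral_le_of_norm_le_const (C := L * M) fun x hx => ?_).trans
      (by simp)
    rw [uIoc_of_le zero_le_one] at hx
    rw [norm_smul]
    exact mul_le_mul (hL j hj x ⟨hx.1.le, hx.2⟩) (hM x ⟨hx.1.le, hx.2⟩) (norm_nonneg _) hL0
  refine (norm_sum_le_of_le _ this).trans ?_
  simp [mul_assoc]

variable [CompleteSpace E]

/-- The truncation error is orthogonal to the retained Legendre polynomials. -/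
theorem integral_legendreP_smul_legendreProj_sub (s i : ℕ) (hi : i < s) {g : ℝ → E}
    (hg : ContinuousOn g (Icc 0 1)) :
    ∫ x in (0 : ℝ)..1, legendreP i x • (legendreProj s g x - g x) = 0 := by
  simp only [smul_sub]
  rw [intervalIntegral.integral_sub
    (intervalIntegrable_smul_of_continuousOn (continuous_legendreP i)
      (continuous_legendreProj s g).continuousOn)
    (intervalIntegrable_smul_of_continuousOn (continuous_legendreP i) hg), sub_eq_zero]
  simp only [legendreProj, Finset.smul_sum, smul_smul]
  rw [intervalIntegral.integral_finsetSum]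
  swap
  · exact fun j _ => Continuous.intervalIntegrable
      (((continuous_legendreP i).mul (continuous_legendreP j)).smul continuous_const) _ _
  simp only [intervalIntegral.integral_smul_const, integral_legendreP_mul, ite_smul, one_smul,
    zero_smul]
  simp [hi]

theorem integral_pow_smul_legendreProj_sub (s i : ℕ) (hi : i < s) {g : ℝ → E}
    (hg : ContinuousOn g (Icc 0 1)) :
    ∫ x in (0 : ℝ)..1, x ^ i • (legendreProj s g x - g x) = 0 := by
  obtain ⟨b, hb⟩ := exists_pow_eq_sum_legendreP s i hi
  simp only [hb, Finset.sum_smul, mul_smul]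
  rw [intervalIntegral.integral_finsetSum]
  swap
  · exact fun j _ => (intervalIntegrable_smul_of_continuousOn (continuous_legendreP j)
      ((continuous_legendreProj s g).continuousOn.sub hg)).smul (b j)
  refine Finset.sum_eq_zero fun j hj => ?_
  rw [intervalIntegral.integral_smul,
    integral_legendreP_smul_legendreProj_sub s j (Finset.mem_range.1 hj) hg, smul_zero]

theorem legendreProj_pow (s i : ℕ) (hi : i < s) (a : E) (c : ℝ) :
    legendreProj s (fun x => x ^ i • a) c = c ^ i • a := by
  obtain ⟨b, hb⟩ := exists_pow_eq_sum_legendreP s i hi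
  rw [hb c, Finset.sum_smul]
  refine Finset.sum_congr rfl fun j hj => ?_
  simp only [smul_smul]
  rw [intervalIntegral.integral_smul_const, smul_smul, mul_comm]
  congr 2
  simp only [hb, Finset.mul_sum]
  rw [intervalIntegral.integral_finsetSum]
  swap
  · exact fun k _ => Continuous.intervalIntegrable
      ((continuous_legendreP j).mul (continuous_const.mul (continuous_legendreP k))) _ _
  simp only [mul_left_comm _ (b _), intervalIntegral.integral_const_mul, integral_legendreP_mul]
  simpa using fun h => absurd (Finset.mem_range.1 hj) (by omega)

end FDEPCA

namespace FDEPCA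

open MeasureTheory Set

/-! ### Uniform jets -/

/-- The family `z i` of functions on `[0, 1]` is `O(b i)`, uniformly in `i`. -/
def UniformBound {ι E : Type*} [NormedAddCommGroup E] (b : ι → ℝ) (z : ι → ℝ → E) : Prop :=
  ∃ C : ℝ, ∀ i, ∀ c ∈ Icc (0 : ℝ) 1, ‖z i c‖ ≤ C * b i

/-- The family `z i` of functions on `[0, 1]` agrees up to `O(h i ^ k)` with polynomials whose
`j`-th coefficient is `O(h i ^ j)`, uniformly in `i`. For `z i c = Z (t + c * h i)` this is what
Taylor's formula gives when `Z` has bounded derivatives up to order `k`; the coefficients are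
recorded for all `j`, but only those with `j < k` are used. -/
def UniformJet {ι E : Type*} [NormedAddCommGroup E] [NormedSpace ℝ E] (h : ι → ℝ) (k : ℕ)
    (z : ι → ℝ → E) : Prop :=
  ∃ a : ℕ → ι → E, (∀ j, ∃ C : ℝ, ∀ i, ‖a j i‖ ≤ C * h i ^ j) ∧
    UniformBound (fun i => h i ^ k) fun i c => z i c - ∑ j ∈ Finset.range k, c ^ j • a j i

section

variable {ι E : Type*} [NormedAddCommGroup E] {b b' : ι → ℝ} {z w : ι → ℝ → E}

theorem UniformBound.congr (hz : UniformBound b z) (hw : ∀ i, EqOn (w i) (z i) (Icc 0 1)) :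
    UniformBound b w := by
  obtain ⟨C, hC⟩ := hz
  exact ⟨C, fun i c hc => by rw [hw i hc]; exact hC i c hc⟩

theorem UniformBound.add (hz : UniformBound b z) (hw : UniformBound b w) :
    UniformBound b fun i c => z i c + w i c := by
  obtain ⟨C, hC⟩ := hz
  obtain ⟨D, hD⟩ := hw
  exact ⟨C + D, fun i c hc => (norm_add_le _ _).trans
    (by rw [add_mul]; exact add_le_add (hC i c hc) (hD i c hc))⟩

/-- The constant of a uniform bound can be taken nonnegative. -/
theorem UniformBound.exists_nonneg (hb : ∀ i, 0 ≤ b i) (hz : UniformBound b z) :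
    ∃ C : ℝ, 0 ≤ C ∧ ∀ i, ∀ c ∈ Icc (0 : ℝ) 1, ‖z i c‖ ≤ C * b i := by
  obtain ⟨C, hC⟩ := hz
  exact ⟨max C 0, le_max_right _ _, fun i c hc => (hC i c hc).trans
    (mul_le_mul_of_nonneg_right (le_max_left _ _) (hb i))⟩

theorem UniformBound.mono (hb : ∀ i, 0 ≤ b i) (hbb : ∀ i, b i ≤ b' i) (hz : UniformBound b z) :
    UniformBound b' z := by
  obtain ⟨C, hC0, hC⟩ := hz.exists_nonneg hb
  exact ⟨C, fun i c hc => (hC i c hc).trans (mul_le_mul_of_nonneg_left (hbb i) hC0)⟩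

end

section

variable {ι E F G : Type*} [NormedAddCommGroup E] [NormedSpace ℝ E]
  [NormedAddCommGroup F] [NormedSpace ℝ F] [NormedAddCommGroup G] [NormedSpace ℝ G]
  {h b b' : ι → ℝ} {z w : ι → ℝ → E} {k l : ℕ}

theorem UniformBound.bilin (B : E →L[ℝ] F →L[ℝ] G) {w : ι → ℝ → F} (hb : ∀ i, 0 ≤ b i)
    (hz : UniformBound b z) (hw : UniformBound b' w) :
    UniformBound (fun i => b i * b' i) fun i c => B (z i c) (w i c) := by
  obtain ⟨C, hC0, hC⟩ := hz.exists_nonneg hb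
  obtain ⟨D, hD⟩ := hw
  refine ⟨‖B‖ * C * D, fun i c hc => (B.le_opNorm₂ _ _).trans ?_⟩
  have h1 : ‖B‖ * ‖z i c‖ ≤ ‖B‖ * (C * b i) :=
    mul_le_mul_of_nonneg_left (hC i c hc) (norm_nonneg B)
  refine (mul_le_mul h1 (hD i c hc) (norm_nonneg _) ?_).trans (le_of_eq (by ring))
  have := hb i
  positivity

theorem UniformBound.clm (A : E →L[ℝ] F) (hz : UniformBound b z) :
    UniformBound b fun i c => A (z i c) := by
  obtain ⟨C, hC⟩ := hz
  refine ⟨‖A‖ * C, fun i c hc => (A.le_opNorm _).trans ?_⟩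
  rw [mul_assoc]
  exact mul_le_mul_of_nonneg_left (hC i c hc) (norm_nonneg _)

theorem UniformBound.monomial (n : ℕ) {a : ι → E} (ha : ∃ C : ℝ, ∀ i, ‖a i‖ ≤ C * b i) :
    UniformBound b fun i c => c ^ n • a i := by
  obtain ⟨C, hC⟩ := ha
  refine ⟨C, fun i c hc => ?_⟩
  rw [norm_smul, norm_pow, Real.norm_eq_abs, abs_of_nonneg hc.1]
  exact (mul_le_of_le_one_left (norm_nonneg _) (pow_le_one₀ hc.1 hc.2)).trans (hC i)

theorem UniformJet.congr (hz : UniformJet h k z) (hw : ∀ i, EqOn (w i) (z i) (Icc 0 1)) :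
    UniformJet h k w := by
  obtain ⟨a, ha, hz⟩ := hz
  exact ⟨a, ha, hz.congr fun i c hc => by simp only [hw i hc]⟩

theorem uniformJet_zero : UniformJet h 0 z ↔ UniformBound (fun _ => 1) z := by
  constructor
  · rintro ⟨a, -, hz⟩
    simpa using hz
  · intro hz
    exact ⟨fun _ _ => 0, fun j => ⟨0, by simp⟩, by simpa using hz⟩

theorem UniformBound.jet (hz : UniformBound (fun i => h i ^ k) z) : UniformJet h k z :=
  ⟨fun _ _ => 0, fun j => ⟨0, by simp⟩, by simpa using hz⟩

theorem UniformJet.add (hz : UniformJet h k z) (hw : UniformJet h k w) :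
    UniformJet h k fun i c => z i c + w i c := by
  obtain ⟨a, ha, hz⟩ := hz
  obtain ⟨a', ha', hw⟩ := hw
  refine ⟨fun j i => a j i + a' j i, fun j => ?_, (hz.add hw).congr fun i c hc => ?_⟩
  · obtain ⟨C, hC⟩ := ha j
    obtain ⟨D, hD⟩ := ha' j
    exact ⟨C + D, fun i => (norm_add_le _ _).trans
      (by rw [add_mul]; exact add_le_add (hC i) (hD i))⟩
  · simp only [smul_add, Finset.sum_add_distrib]
    abel

theorem UniformJet.sum {J : Type*} (s : Finset J) {z : J → ι → ℝ → E}
    (hz : ∀ j ∈ s, UniformJet h k (z j)) : UniformJet h k fun i c => ∑ j ∈ s, z j i c := by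
  classical
  induction s using Finset.induction_on with
  | empty => exact UniformBound.jet ⟨0, by simp⟩
  | insert j s hj ih =>
    simp only [Finset.sum_insert hj]
    exact (hz j (by simp)).add (ih fun k hk => hz k (by simp [hk]))

theorem UniformJet.clm (A : E →L[ℝ] F) (hz : UniformJet h k z) :
    UniformJet h k fun i c => A (z i c) := by
  obtain ⟨a, ha, hz⟩ := hz
  refine ⟨fun j i => A (a j i), fun j => ?_, (hz.clm A).congr fun i c hc => ?_⟩
  · obtain ⟨C, hC⟩ := ha j
    refine ⟨‖A‖ * C, fun i => (A.le_opNorm _).trans ?_⟩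
    rw [mul_assoc]
    exact mul_le_mul_of_nonneg_left (hC i) (norm_nonneg _)
  · simp

/-- A jet is the sum of monomials and a remainder. -/
theorem UniformJet.exists_eq (hz : UniformJet h k z) :
    ∃ (a : ℕ → ι → E) (r : ι → ℝ → E), (∀ j, ∃ C : ℝ, ∀ i, ‖a j i‖ ≤ C * h i ^ j) ∧
      UniformBound (fun i => h i ^ k) r ∧
      ∀ i c, z i c = (∑ j ∈ Finset.range k, c ^ j • a j i) + r i c := by
  obtain ⟨a, ha, hz⟩ := hz
  exact ⟨a, _, ha, hz, fun i c => by abel⟩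

/-- The truncation error of the Legendre expansion of an `s`-jet is `O(h ^ s)`. -/
theorem UniformJet.legendreProj_sub [CompleteSpace E] {s : ℕ}
    (hz : ∀ i, ContinuousOn (z i) (Icc 0 1)) (hzj : UniformJet h s z) :
    UniformBound (fun i => h i ^ s) fun i c => FDEPCA.legendreProj s (z i) c - z i c := by
  obtain ⟨a, r, ha, ⟨R, hR⟩, hz'⟩ := hzj.exists_eq
  obtain ⟨L, -, hL⟩ := exists_norm_legendreProj_le (E := E) s
  have hp : ∀ i, Continuous fun c : ℝ => ∑ j ∈ Finset.range s, c ^ j • a j i := fun i => by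
    fun_prop
  have hrc : ∀ i, ContinuousOn (r i) (Icc 0 1) := fun i => by
    refine ((hz i).sub (hp i).continuousOn).congr fun c _ => ?_
    simp [hz' i c]
  have h1 : UniformBound (fun i => h i ^ s) fun i => FDEPCA.legendreProj s (r i) :=
    ⟨L * R, fun i c hc => by rw [mul_assoc]; exact hL _ _ (hR i) c hc⟩
  have h2 : UniformBound (fun i => h i ^ s) fun i c => - r i c :=
    ⟨R, fun i c hc => by rw [norm_neg]; exact hR i c hc⟩
  refine (h1.add h2).congr fun i c _ => ?_
  simp only
  rw [legendreProj_congr s (fun x _ => hz' i x),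
    legendreProj_add s (hp i).continuousOn (hrc i), legendreProj_finsetSum]
  · rw [hz' i c, Finset.sum_congr rfl fun j hj =>
      legendreProj_pow s j (Finset.mem_range.1 hj) (a j i) c]
    abel
  · intro j _
    fun_prop

/-- Pairing an `s`-jet with the truncation error of another one gains a second factor `h ^ s`, as
the polynomial part of the first is orthogonal to the error. -/
theorem UniformJet.integral_legendreProj_sub [CompleteSpace E] [CompleteSpace F] {s : ℕ}
    {N : ι → ℝ → E →L[ℝ] F}
    (hN : ∀ i, ContinuousOn (N i) (Icc 0 1)) (hNj : UniformJet h s N)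
    (hz : ∀ i, ContinuousOn (z i) (Icc 0 1)) (hzj : UniformJet h s z) :
    ∃ C : ℝ, ∀ i, ‖∫ c in (0 : ℝ)..1, N i c (FDEPCA.legendreProj s (z i) c - z i c)‖ ≤
      C * h i ^ (2 * s) := by
  obtain ⟨a, r, ha, ⟨R, hR⟩, hN'⟩ := hNj.exists_eq
  obtain ⟨D, hD⟩ := hzj.legendreProj_sub hz
  refine ⟨R * D, fun i => ?_⟩
  have hp : Continuous fun c : ℝ => ∑ j ∈ Finset.range s, c ^ j • a j i := by fun_prop
  have hrc : ContinuousOn (r i) (Icc 0 1) := by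
    refine ((hN i).sub hp.continuousOn).congr fun c _ => ?_
    simp [hN' i c]
  have hδ : ContinuousOn (fun c => FDEPCA.legendreProj s (z i) c - z i c) (Icc 0 1) :=
    (continuous_legendreProj s (z i)).continuousOn.sub (hz i)
  have hzero : ∫ c in (0 : ℝ)..1, (∑ j ∈ Finset.range s, c ^ j • a j i)
      (FDEPCA.legendreProj s (z i) c - z i c) = 0 := by
    simp only [sum_apply, smul_apply, ← map_smul]
    have hint : ∀ j : ℕ, IntervalIntegrable
        (fun c : ℝ => c ^ j • (FDEPCA.legendreProj s (z i) c - z i c)) volume 0 1 := fun j =>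
      intervalIntegrable_smul_of_continuousOn (continuous_pow j) hδ
    rw [intervalIntegral.integral_finsetSum]
    swap
    · exact fun j _ => ContinuousOn.intervalIntegrable_of_Icc zero_le_one
        ((a j i).continuous.comp_continuousOn ((continuous_pow j).continuousOn.smul hδ))
    refine Finset.sum_eq_zero fun j hj => ?_
    rw [ContinuousLinearMap.intervalIntegral_comp_comm _ (hint j),
      integral_pow_smul_legendreProj_sub s j (Finset.mem_range.1 hj) (hz i), map_zero]
  have hsplit : ∫ c in (0 : ℝ)..1, N i c (FDEPCA.legendreProj s (z i) c - z i c) =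
      ∫ c in (0 : ℝ)..1, r i c (FDEPCA.legendreProj s (z i) c - z i c) := by
    rw [← add_zero (∫ c in (0 : ℝ)..1, r i c _), ← hzero, ← intervalIntegral.integral_add
      (ContinuousOn.intervalIntegrable_of_Icc zero_le_one (hrc.clm_apply hδ))
      (ContinuousOn.intervalIntegrable_of_Icc zero_le_one (hp.continuousOn.clm_apply hδ))]
    congr 1
    ext c
    rw [hN' i c, add_comm, add_apply]
  rw [hsplit]
  refine (intervalIntegral.norm_integral_le_of_norm_le_const
    (C := R * D * h i ^ (2 * s)) fun x hx => ?_).trans (by simp)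
  rw [uIoc_of_le zero_le_one] at hx
  have hx : x ∈ Icc (0 : ℝ) 1 := ⟨hx.1.le, hx.2⟩
  refine (ContinuousLinearMap.le_opNorm _ _).trans ((mul_le_mul (hR i x hx) (hD i x hx)
    (norm_nonneg _) ((norm_nonneg _).trans (hR i x hx))).trans (le_of_eq (by ring)))

variable (hh : ∀ i, 0 < h i ∧ h i ≤ 1)
include hh

theorem UniformJet.monomial (k n : ℕ) {a : ι → E} (ha : ∃ C : ℝ, ∀ i, ‖a i‖ ≤ C * h i ^ n) :
    UniformJet h k fun i c => c ^ n • a i := by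
  classical
  by_cases hn : n < k
  · refine ⟨fun j i => if j = n then a i else 0, fun j => ?_, ⟨0, fun i c hc => ?_⟩⟩
    · by_cases hj : j = n
      · subst hj; simpa using ha
      · exact ⟨0, by simp [hj]⟩
    · simp [hn]
  · exact ((UniformBound.monomial n ha).mono (fun i => (pow_pos (hh i).1 _).le) fun i =>
      pow_le_pow_of_le_one (hh i).1.le (hh i).2 (by omega)).jet

theorem UniformJet.mono (hlk : l ≤ k) (hz : UniformJet h k z) : UniformJet h l z := by
  obtain ⟨a, r, ha, hr, hz⟩ := hz.exists_eq
  refine ((UniformJet.sum (Finset.range k) fun j _ => UniformJet.monomial hh l j (ha j)).add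
    (hr.mono (fun i => (pow_pos (hh i).1 _).le) fun i =>
      pow_le_pow_of_le_one (hh i).1.le (hh i).2 hlk).jet).congr fun i c _ => hz i c

theorem UniformJet.bound (hz : UniformJet h k z) : UniformBound (fun _ => 1) z :=
  uniformJet_zero.1 (hz.mono hh (Nat.zero_le _))

/-- Jets can be multiplied: only the product of two polynomials contributes more than a
remainder. -/
theorem UniformJet.bilin (B : E →L[ℝ] F →L[ℝ] G) {w : ι → ℝ → F}
    (hz : UniformJet h k z) (hw : UniformJet h k w) :
    UniformJet h k fun i c => B (z i c) (w i c) := by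
  have hwb := hw.bound hh
  obtain ⟨a, r, ha, hr, hz'⟩ := hz.exists_eq
  obtain ⟨a', r', ha', hr', hw'⟩ := hw.exists_eq
  have hpos : ∀ n i, 0 ≤ h i ^ n := fun n i => (pow_pos (hh i).1 _).le
  have hp : UniformBound (fun _ => (1 : ℝ)) fun i c => ∑ j ∈ Finset.range k, c ^ j • a j i :=
    (UniformJet.sum (Finset.range k) fun j _ => UniformJet.monomial hh 0 j (ha j)).bound hh
  have h1 : UniformJet h k fun i c => B (r i c) (w i c) :=
    UniformBound.jet (by simpa using UniformBound.bilin B (hpos k) hr hwb)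
  have h2 : UniformJet h k fun i c => B (∑ j ∈ Finset.range k, c ^ j • a j i) (r' i c) :=
    UniformBound.jet (by simpa using UniformBound.bilin B (fun _ => zero_le_one) hp hr')
  have h3 : UniformJet h k fun i c => ∑ j ∈ Finset.range k, ∑ l ∈ Finset.range k,
      c ^ (j + l) • B (a j i) (a' l i) := by
    refine UniformJet.sum _ fun j _ => UniformJet.sum _ fun l _ =>
      UniformJet.monomial hh k (j + l) ?_
    obtain ⟨C, hC⟩ := ha j
    obtain ⟨D, hD⟩ := ha' l
    refine ⟨‖B‖ * (C * D), fun i => (B.le_opNorm₂ _ _).trans ?_⟩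
    rw [mul_assoc, mul_assoc]
    refine mul_le_mul_of_nonneg_left ?_ (norm_nonneg B)
    refine (mul_le_mul (hC i) (hD i) (norm_nonneg _)
      ((norm_nonneg _).trans (hC i))).trans (le_of_eq (by ring))
  refine ((h1.add h2).add h3).congr fun i c _ => ?_
  have e : ∑ j ∈ Finset.range k, ∑ l ∈ Finset.range k, c ^ (j + l) • B (a j i) (a' l i) =
      B (∑ j ∈ Finset.range k, c ^ j • a j i) (∑ j ∈ Finset.range k, c ^ j • a' j i) := by
    simp only [map_sum, sum_apply, map_smul, smul_apply,
      pow_add, smul_smul, Finset.smul_sum]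
    rw [Finset.sum_comm]
    simp only [mul_comm]
  simp only [e, hz' i c, hw' i c, map_add, add_apply]
  abel

/-- If the rescaled derivative `z' / h` has a `k`-jet, then `z` has a `(k + 1)`-jet. -/
theorem UniformJet.primitive [CompleteSpace E] {g : ι → ℝ → E}
    (hz : ∀ i, ContinuousOn (z i) (Icc 0 1))
    (hd : ∀ i, ∀ c ∈ Ioo (0 : ℝ) 1, HasDerivAt (z i) (h i • g i c) c)
    (hg : ∀ i, ContinuousOn (g i) (Icc 0 1)) (h0 : ∃ C : ℝ, ∀ i, ‖z i 0‖ ≤ C)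
    (hgj : UniformJet h k g) : UniformJet h (k + 1) z := by
  obtain ⟨a, r, ha, ⟨R, hR⟩, hg'⟩ := hgj.exists_eq
  have h1 : UniformJet h (k + 1) fun i c => ∑ j ∈ Finset.range k,
      c ^ (j + 1) • ((h i / (j + 1 : ℝ)) • a j i) := by
    refine UniformJet.sum _ fun j _ => UniformJet.monomial hh (k + 1) (j + 1) ?_
    obtain ⟨C, hC⟩ := ha j
    refine ⟨C, fun i => ?_⟩
    rw [norm_smul, pow_succ, ← mul_assoc, mul_comm]
    refine mul_le_mul (hC i) ?_ (norm_nonneg _) ((norm_nonneg _).trans (hC i))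
    rw [Real.norm_of_nonneg (div_nonneg (hh i).1.le (by positivity))]
    exact div_le_self (hh i).1.le (by linarith [(Nat.cast_nonneg j : (0 : ℝ) ≤ j)])
  have h2 : UniformJet h (k + 1) fun i c => c ^ 0 • z i 0 :=
    UniformJet.monomial hh (k + 1) 0 (by simpa using h0)
  have hrc : ∀ i, ContinuousOn (r i) (Icc 0 1) := fun i => by
    refine ((hg i).sub (Continuous.continuousOn (s := Icc 0 1) (f := fun c : ℝ =>
      ∑ j ∈ Finset.range k, c ^ j • a j i) (by fun_prop))).congr fun c _ => ?_
    simp [hg' i c]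
  have h3 : UniformJet h (k + 1) fun i c => h i • ∫ x in (0 : ℝ)..c, r i x := by
    refine UniformBound.jet ⟨R, fun i c hc => ?_⟩
    change _ ≤ R * h i ^ (k + 1)
    rw [norm_smul, Real.norm_of_nonneg (hh i).1.le, pow_succ, mul_comm, ← mul_assoc]
    refine mul_le_mul_of_nonneg_right ?_ (hh i).1.le
    have hR0 : 0 ≤ R * h i ^ k := (norm_nonneg _).trans (hR i c hc)
    refine (intervalIntegral.norm_integral_le_of_norm_le_const (C := R * h i ^ k)
      fun x hx => ?_).trans ?_
    · rw [uIoc_of_le hc.1] at hx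
      exact hR i x ⟨hx.1.le, hx.2.trans hc.2⟩
    · rw [sub_zero, abs_of_nonneg hc.1]
      exact mul_le_of_le_one_right hR0 hc.2
  refine ((h2.add h1).add h3).congr fun i c hc => ?_
  have hsub : Icc 0 c ⊆ Icc (0 : ℝ) 1 := Icc_subset_Icc le_rfl hc.2
  have hI := intervalIntegral.integral_eq_sub_of_hasDerivAt_of_le hc.1 ((hz i).mono hsub)
    (fun x hx => hd i x ⟨hx.1, hx.2.trans_le hc.2⟩)
    (ContinuousOn.intervalIntegrable_of_Icc hc.1 (((hg i).mono hsub).const_smul (h i)))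
  rw [eq_sub_iff_add_eq] at hI
  rw [← hI, intervalIntegral.integral_smul, intervalIntegral.integral_congr (g := fun x =>
    (∑ j ∈ Finset.range k, x ^ j • a j i) + r i x) fun x _ => hg' i x,
    intervalIntegral.integral_add (Continuous.intervalIntegrable (by fun_prop) _ _)
      (ContinuousOn.intervalIntegrable_of_Icc hc.1 ((hrc i).mono hsub)),
    intervalIntegral.integral_finsetSum fun j _ =>
      Continuous.intervalIntegrable (by fun_prop) _ _]
  simp only [intervalIntegral.integral_smul_const, integral_pow, smul_add, Finset.smul_sum,
    smul_smul, pow_zero, one_smul]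
  have : ∀ j : ℕ, h i * ((c ^ (j + 1) - 0 ^ (j + 1)) / (j + 1 : ℝ)) =
      c ^ (j + 1) * (h i / (j + 1)) := fun j => by
    rw [zero_pow (by omega)]; ring
  simp only [this]
  abel

/-- The truncated Legendre expansion preserves `k`-jets for `k ≤ s`: it reproduces the polynomial
part and is bounded on the remainder. -/
theorem UniformJet.legendreProj [CompleteSpace E] {s : ℕ} (hks : k ≤ s)
    (hz : ∀ i, ContinuousOn (z i) (Icc 0 1)) (hzj : UniformJet h k z) :
    UniformJet h k fun i => FDEPCA.legendreProj s (z i) := by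
  obtain ⟨a, r, ha, ⟨R, hR⟩, hz'⟩ := hzj.exists_eq
  obtain ⟨L, -, hL⟩ := exists_norm_legendreProj_le (E := E) s
  have hp : ∀ i, Continuous fun c : ℝ => ∑ j ∈ Finset.range k, c ^ j • a j i := fun i => by
    fun_prop
  have hrc : ∀ i, ContinuousOn (r i) (Icc 0 1) := fun i => by
    refine ((hz i).sub (hp i).continuousOn).congr fun c _ => ?_
    simp [hz' i c]
  refine ((UniformJet.sum (Finset.range k) fun j _ => UniformJet.monomial hh k j (ha j)).add
    (UniformBound.jet (z := fun i => FDEPCA.legendreProj s (r i))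
      ⟨L * R, fun i c hc => by rw [mul_assoc]; exact hL _ _ (hR i) c hc⟩)).congr fun i c _ => ?_
  rw [legendreProj_congr s (fun x _ => hz' i x),
    legendreProj_add s (hp i).continuousOn (hrc i), legendreProj_finsetSum]
  · congr 1
    exact Finset.sum_congr rfl fun j hj =>
      legendreProj_pow s j ((Finset.mem_range.1 hj).trans_le hks) _ _
  · intro j _
    fun_prop

end

/-! ### Jets of solutions -/

section

universe u

theorem hasDerivAt_prodMk_const {E : Type*} [NormedAddCommGroup E] [NormedSpace ℝ E]
    {z : ℝ → E} {φ z' : E} {t c : ℝ} (hd : HasDerivAt z (t • z') c) :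
    HasDerivAt (fun x => (z x, φ)) (t • ContinuousLinearMap.inl ℝ E E z') c := by
  simpa using hd.prodMk (hasDerivAt_const c φ)

variable {ι : Type*} {E : Type u} [NormedAddCommGroup E] [NormedSpace ℝ E] [FiniteDimensional ℝ E]
  {h : ι → ℝ}

theorem exists_norm_le_of_continuous {X G : Type*} [NormedAddCommGroup X] [NormedSpace ℝ X]
    [FiniteDimensional ℝ X] [NormedAddCommGroup G] {Φ : X → G} (hΦ : Continuous Φ) (R : ℝ) :
    ∃ C : ℝ, ∀ p : X, ‖p‖ ≤ R → ‖Φ p‖ ≤ C := by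
  have := FiniteDimensional.proper_real X
  obtain ⟨C, hC⟩ := (isCompact_closedBall (0 : X) R).exists_bound_of_continuousOn hΦ.continuousOn
  exact ⟨C, fun p hp => hC p (by simpa using hp)⟩

/-- Composition with a `C^k` function preserves `k`-jets of differentiable families: the chain rule
reduces this to `(k - 1)`-jets of the derivative, and a jet gains one order by integration. -/
theorem UniformJet.comp (hh : ∀ i, 0 < h i ∧ h i ≤ 1) {z g : ι → ℝ → E} {R : ℝ}
    (hz : ∀ i, ContinuousOn (z i) (Icc 0 1))
    (hd : ∀ i, ∀ c ∈ Ioo (0 : ℝ) 1, HasDerivAt (z i) (h i • g i c) c)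
    (hg : ∀ i, ContinuousOn (g i) (Icc 0 1))
    (hR : ∀ i, ∀ c ∈ Icc (0 : ℝ) 1, ‖z i c‖ ≤ R) (k : ℕ) (hgj : UniformJet h (k - 1) g)
    {G : Type u} [NormedAddCommGroup G] [NormedSpace ℝ G] [CompleteSpace G] {Φ : E → G}
    (hΦ : ContDiff ℝ k Φ) : UniformJet h k fun i c => Φ (z i c) := by
  induction k generalizing G with
  | zero =>
    obtain ⟨C, hC⟩ := exists_norm_le_of_continuous hΦ.continuous R
    exact uniformJet_zero.2 ⟨C, fun i c hc => by simpa using hC _ (hR i c hc)⟩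
  | succ k ih =>
    rw [Nat.add_sub_cancel] at hgj
    have hD : ContDiff ℝ k (fderiv ℝ Φ) := hΦ.fderiv_right (by norm_cast)
    have hdiff : Differentiable ℝ Φ := hΦ.differentiable (by norm_cast)
    obtain ⟨C, hC⟩ := exists_norm_le_of_continuous hΦ.continuous R
    refine UniformJet.primitive hh (g := fun i c => fderiv ℝ Φ (z i c) (g i c))
      (fun i => hΦ.continuous.comp_continuousOn (hz i)) (fun i c hc => ?_)
      (fun i => (hD.continuous.comp_continuousOn (hz i)).clm_apply (hg i))
      ⟨C, fun i => hC _ (hR i 0 ⟨le_rfl, zero_le_one⟩)⟩ ?_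
    · rw [← map_smul]
      exact (hdiff (z i c)).hasFDerivAt.comp_hasDerivAt c (hd i c hc)
    · exact (ih (hgj.mono hh (by omega)) hD).bilin hh (ContinuousLinearMap.id ℝ (E →L[ℝ] G)) hgj

variable {F : E × E → E} {R : ℝ}

/-- `UniformJet.comp` for functions of a second argument that is constant in each member of the
family, like the memory term. -/
theorem UniformJet.comp_prodMk (hh : ∀ i, 0 < h i ∧ h i ≤ 1) {z g : ι → ℝ → E} {φ : ι → E}
    (hz : ∀ i, ContinuousOn (z i) (Icc 0 1))
    (hd : ∀ i, ∀ c ∈ Ioo (0 : ℝ) 1, HasDerivAt (z i) (h i • g i c) c)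
    (hg : ∀ i, ContinuousOn (g i) (Icc 0 1))
    (hR : ∀ i, ∀ c ∈ Icc (0 : ℝ) 1, ‖z i c‖ ≤ R) (hφ : ∀ i, ‖φ i‖ ≤ R) {k : ℕ}
    (hgj : UniformJet h (k - 1) g)
    {G : Type u} [NormedAddCommGroup G] [NormedSpace ℝ G] [CompleteSpace G] {Φ : E × E → G}
    (hΦ : ContDiff ℝ k Φ) : UniformJet h k fun i c => Φ (z i c, φ i) :=
  UniformJet.comp hh (z := fun i c => (z i c, φ i)) (R := R)
    (fun i => (hz i).prodMk continuousOn_const)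
    (fun i c hc => hasDerivAt_prodMk_const (hd i c hc))
    (fun i => (ContinuousLinearMap.inl ℝ E E).continuous.comp_continuousOn (hg i))
    (fun i c hc => max_le (hR i c hc) (hφ i)) k (hgj.clm (ContinuousLinearMap.inl ℝ E E)) hΦ

/-- Bootstrapping: along solutions of an equation `z' = h • T (F (z, φ))`, where `T` preserves jets,
the right-hand side gains one order of smoothness after another. -/
theorem UniformJet.bootstrap (hh : ∀ i, 0 < h i ∧ h i ≤ 1) {z g : ι → ℝ → E} {φ : ι → E} {n r : ℕ}
    (hF : ContDiff ℝ n F)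
    (hz : ∀ i, ContinuousOn (z i) (Icc 0 1))
    (hd : ∀ i, ∀ c ∈ Ioo (0 : ℝ) 1, HasDerivAt (z i) (h i • g i c) c)
    (hg : ∀ i, ContinuousOn (g i) (Icc 0 1))
    (hR : ∀ i, ∀ c ∈ Icc (0 : ℝ) 1, ‖z i c‖ ≤ R) (hφ : ∀ i, ‖φ i‖ ≤ R)
    (hT : ∀ k < r, UniformJet h k (fun i c => F (z i c, φ i)) → UniformJet h k g)
    (k : ℕ) (hkn : k ≤ n) (hkr : k ≤ r) : UniformJet h k fun i c => F (z i c, φ i) := by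
  induction k with
  | zero =>
    obtain ⟨C, hC⟩ := exists_norm_le_of_continuous hF.continuous R
    exact uniformJet_zero.2 ⟨C, fun i c hc => by
      simpa using hC (z i c, φ i) (max_le (hR i c hc) (hφ i))⟩
  | succ k ih =>
    exact UniformJet.comp_prodMk (k := k + 1) hh hz hd hg hR hφ
      (hT k (by omega) (ih (by omega) (by omega)))
      (hF.of_le (by exact_mod_cast hkn))

/-- Lipschitz and second order Taylor bounds on a ball. -/
theorem exists_taylor_bound {X Y : Type*} [NormedAddCommGroup X] [NormedSpace ℝ X]
    [FiniteDimensional ℝ X] [NormedAddCommGroup Y] [NormedSpace ℝ Y] {Φ : X → Y}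
    (hΦ : ContDiff ℝ 2 Φ) (R : ℝ) : ∃ L : ℝ, 0 ≤ L ∧ ∀ p q : X, ‖p‖ ≤ R → ‖q‖ ≤ R →
      ‖fderiv ℝ Φ p‖ ≤ L ∧ ‖Φ q - Φ p‖ ≤ L * ‖q - p‖ ∧
      ‖Φ q - Φ p - fderiv ℝ Φ p (q - p)‖ ≤ L * ‖q - p‖ ^ 2 := by
  have hD : ContDiff ℝ 1 (fderiv ℝ Φ) := hΦ.fderiv_right (by norm_num)
  have hD2 : ContDiff ℝ 0 (fderiv ℝ (fderiv ℝ Φ)) := hD.fderiv_right (by norm_num)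
  have hdiff : Differentiable ℝ Φ := hΦ.differentiable (by norm_num)
  have hDdiff : Differentiable ℝ (fderiv ℝ Φ) := hD.differentiable (by norm_num)
  obtain ⟨C, hC⟩ := exists_norm_le_of_continuous hD.continuous R
  obtain ⟨D, hD⟩ := exists_norm_le_of_continuous hD2.continuous R
  refine ⟨max (max C D) 0, le_max_right _ _, fun p q hp hq => ?_⟩
  have hball : Convex ℝ (Metric.closedBall (0 : X) R) := convex_closedBall 0 R
  have hp' : p ∈ Metric.closedBall (0 : X) R := by simpa using hp
  have hq' : q ∈ Metric.closedBall (0 : X) R := by simpa using hq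
  have hseg : ∀ x ∈ segment ℝ p q, x ∈ Metric.closedBall (0 : X) R :=
    fun x hx => hball.segment_subset hp' hq' hx
  have hmC : ∀ x, ‖x‖ ≤ R → ‖fderiv ℝ Φ x‖ ≤ max (max C D) 0 := fun x hx =>
    (hC x hx).trans ((le_max_left _ _).trans (le_max_left _ _))
  have hmD : ∀ x, ‖x‖ ≤ R → ‖fderiv ℝ (fderiv ℝ Φ) x‖ ≤ max (max C D) 0 := fun x hx =>
    (hD x hx).trans ((le_max_right _ _).trans (le_max_left _ _))
  refine ⟨hmC p hp, hball.norm_image_sub_le_of_norm_fderiv_le (fun x _ => hdiff x)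
    (fun x hx => hmC x (by simpa using hx)) hp' hq', ?_⟩
  rw [pow_two, ← mul_assoc]
  refine (convex_segment p q).norm_image_sub_le_of_norm_fderiv_le' (fun x _ => hdiff x)
    (fun x hx => ?_) (left_mem_segment ℝ p q) (right_mem_segment ℝ p q)
  refine (hball.norm_image_sub_le_of_norm_fderiv_le (fun x _ => hDdiff x)
    (fun x hx => hmD x (by simpa using hx)) hp' (hseg x hx)).trans ?_
  refine mul_le_mul_of_nonneg_left ?_ (le_max_right _ _)
  obtain ⟨t, ht, rfl⟩ := (segment_eq_image' ℝ p q) ▸ hx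
  simp only [add_sub_cancel_left, norm_smul, Real.norm_of_nonneg ht.1]
  exact mul_le_of_le_one_left (norm_nonneg _) ht.2

end

/-! ### Superconvergence over one step -/

section

variable {ι E : Type*} [NormedAddCommGroup E] [NormedSpace ℝ E] {h e : ι → ℝ} {s : ℕ}

theorem hasDerivWithinAt_Ici_of_hasDerivAt_Ioo {w w' : ℝ → E} (hw : ContinuousOn w (Icc 0 1))
    (hd : ∀ c ∈ Ioo (0 : ℝ) 1, HasDerivAt w (w' c) c) (hw' : ContinuousOn w' (Icc 0 1)) :
    ∀ c ∈ Ico (0 : ℝ) 1, HasDerivWithinAt w (w' c) (Ici c) c := by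
  intro c hc
  rcases hc.1.eq_or_lt with rfl | h0
  · refine hasDerivWithinAt_Ici_of_tendsto_deriv (s := Ioo 0 1)
      (fun x hx => (hd x hx).differentiableAt.differentiableWithinAt)
      ((hw 0 ⟨le_rfl, zero_le_one⟩).mono Ioo_subset_Icc_self) (Ioo_mem_nhdsGT zero_lt_one) ?_
    have h1 : Filter.Tendsto w' (nhdsWithin 0 (Ioi 0)) (nhds (w' 0)) := by
      rw [← nhdsWithin_Ioo_eq_nhdsGT zero_lt_one]
      exact (hw' 0 ⟨le_rfl, zero_le_one⟩).mono Ioo_subset_Icc_self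
    refine h1.congr' ?_
    filter_upwards [Ioo_mem_nhdsGT (zero_lt_one' ℝ)] with x hx
    exact (hd x hx).deriv.symm
  · exact (hd c ⟨h0, hc.2⟩).hasDerivWithinAt

/-- Grönwall's inequality on `[0, 1]`. -/
theorem norm_le_of_norm_deriv_le {w w' : ℝ → E} {K ε : ℝ} (hK : 0 < K) (hε : 0 ≤ ε)
    (hw : ContinuousOn w (Icc 0 1))
    (hd : ∀ c ∈ Ioo (0 : ℝ) 1, HasDerivAt w (w' c) c) (hw' : ContinuousOn w' (Icc 0 1))
    (hb : ∀ c ∈ Icc (0 : ℝ) 1, ‖w' c‖ ≤ K * ‖w c‖ + ε) {c : ℝ} (hc : c ∈ Icc (0 : ℝ) 1) :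
    ‖w c‖ ≤ Real.exp K * (‖w 0‖ + ε / K) := by
  have := norm_le_gronwallBound_of_norm_deriv_right_le hw
    (hasDerivWithinAt_Ici_of_hasDerivAt_Ioo hw hd hw') le_rfl
    (fun x hx => hb x ⟨hx.1, hx.2.le⟩) c hc
  rw [gronwallBound_of_K_ne_0 hK.ne', sub_zero] at this
  have h1 : Real.exp (K * c) ≤ Real.exp K :=
    Real.exp_le_exp.2 (mul_le_of_le_one_right hK.le hc.2)
  have h2 : 0 ≤ ε / K := by positivity
  nlinarith [norm_nonneg (w 0)]

variable [CompleteSpace E]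

/-- Let `w` solve the linear equation `w' = h (A w + ε + (Π g - g))`, with `Π` the truncated
Legendre expansion. Integrals of `w` against an operator-valued `s`-jet `M = O(h ^ j)` are as small
as the data `e` and `h ^ (2 s)`: integration by parts replaces `M` by `N A`, where `N` is the
primitive of `h M`, and this is of size `h ^ (j + 1)`. The truncation error contributes only the
product of two factors `h ^ s`, since it is orthogonal to the polynomial part of `N`. -/
theorem exists_norm_integral_jet_apply_le (hh : ∀ i, 0 < h i ∧ h i ≤ 1) (he : ∀ i, 0 ≤ e i)
    {w ε g : ι → ℝ → E} {A : ι → ℝ → E →L[ℝ] E}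
    (hw : ∀ i, ContinuousOn (w i) (Icc 0 1))
    (hd : ∀ i, ∀ c ∈ Ioo (0 : ℝ) 1, HasDerivAt (w i)
      (h i • (A i c (w i c) + ε i c + (legendreProj s (g i) c - g i c))) c)
    (hA : ∀ i, ContinuousOn (A i) (Icc 0 1)) (hAj : UniformJet h s A)
    (hε : ∀ i, ContinuousOn (ε i) (Icc 0 1))
    (hεb : UniformBound (fun i => e i + h i ^ (2 * s)) ε)
    (hg : ∀ i, ContinuousOn (g i) (Icc 0 1)) (hgj : UniformJet h s g)
    (hwb : UniformBound (fun i => e i + h i ^ (s + 1)) w) (hw0 : ∀ i, ‖w i 0‖ ≤ e i)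
    (d j : ℕ) (hdj : j + d + 1 = s) {M : ι → ℝ → E →L[ℝ] E}
    (hM : ∀ i, ContinuousOn (M i) (Icc 0 1)) (hMj : UniformJet h s M)
    (hMb : UniformBound (fun i => h i ^ j) M) :
    ∃ C : ℝ, ∀ i, ‖∫ c in (0 : ℝ)..1, M i c (w i c)‖ ≤ C * (e i + h i ^ (2 * s)) := by
  have hpos : ∀ n i, 0 < h i ^ n := fun n i => pow_pos (hh i).1 _
  have hint : ∀ {C : ℝ} {z : ℝ → E}, (∀ c ∈ Icc (0 : ℝ) 1, ‖z c‖ ≤ C) →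
      ‖∫ c in (0 : ℝ)..1, z c‖ ≤ C := fun {C z} hz => by
    refine (intervalIntegral.norm_integral_le_of_norm_le_const (C := C) fun x hx => ?_).trans
      (by simp)
    rw [uIoc_of_le zero_le_one] at hx
    exact hz x ⟨hx.1.le, hx.2⟩
  induction d generalizing j M with
  | zero =>
    have := (hMb.bilin (ContinuousLinearMap.id ℝ (E →L[ℝ] E)) (fun i => (hpos j i).le) hwb)
    obtain ⟨C, hC⟩ := this.mono (b' := fun i => e i + h i ^ (2 * s))
      (fun i => mul_nonneg (hpos j i).le (add_nonneg (he i) (hpos _ i).le)) fun i => by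
        rw [mul_add, ← pow_add]
        refine add_le_add (mul_le_of_le_one_left (he i) (pow_le_one₀ (hh i).1.le (hh i).2)) ?_
        exact (pow_le_pow_of_le_one (hh i).1.le (hh i).2 (by omega))
    exact ⟨C, fun i => hint (hC i)⟩
  | succ d ih =>
    obtain ⟨B, hB0, hB⟩ := hMb.exists_nonneg fun i => (hpos j i).le
    have hB' : ∀ i, ∀ c ∈ Icc (0 : ℝ) 1, ‖∫ x in c..1, M i x‖ ≤ B * h i ^ j := by
      intro i c hc
      refine (intervalIntegral.norm_integral_le_of_norm_le_const (C := B * h i ^ j)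
        fun x hx => ?_).trans ?_
      · rw [uIoc_of_le hc.2] at hx
        exact hB i x ⟨hc.1.trans hx.1.le, hx.2⟩
      · rw [abs_of_nonneg (by linarith [hc.2])]
        exact mul_le_of_le_one_right (mul_nonneg hB0 (hpos j i).le) (by linarith [hc.1])
    set N : ι → ℝ → E →L[ℝ] E := fun i c => h i • ∫ x in c..1, M i x with hNdef
    have hMint : ∀ i, IntegrableOn (M i) (Icc 0 1) := fun i => (hM i).integrableOn_Icc
    have hNc : ∀ i, ContinuousOn (N i) (Icc 0 1) := fun i => by
      have := intervalIntegral.continuousOn_primitive_interval_left (f := M i) (a := 0) (b := 1)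
        (μ := volume) (by rw [uIcc_of_le zero_le_one]; exact hMint i)
      rw [uIcc_of_le zero_le_one] at this
      exact this.const_smul (h i)
    have hNd : ∀ i, ∀ c ∈ Ioo (0 : ℝ) 1, HasDerivAt (N i) (h i • -M i c) c := fun i c hc => by
      have hcc : Icc (0 : ℝ) 1 ∈ nhds c := Icc_mem_nhds hc.1 hc.2
      refine (intervalIntegral.integral_hasDerivAt_left ?_ ?_ ?_).fun_const_smul (h i)
      · exact ((hM i).mono (Icc_subset_Icc hc.1.le le_rfl)).intervalIntegrable_of_Icc hc.2.le
      · exact (hM i).stronglyMeasurableAtFilter_nhdsWithin measurableSet_Icc c |>.filter_mono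
          (by rw [nhdsWithin_eq_nhds.2 hcc])
      · exact (hM i).continuousAt hcc
    have hNb : UniformBound (fun i => h i ^ (j + 1)) N := ⟨B, fun i c hc => by
      change _ ≤ B * h i ^ (j + 1)
      rw [hNdef, norm_smul, Real.norm_of_nonneg (hh i).1.le, pow_succ, mul_comm, ← mul_assoc]
      exact mul_le_mul_of_nonneg_right (hB' i c hc) (hh i).1.le⟩
    have hN1 : UniformBound (fun _ => (1 : ℝ)) N := hNb.mono (fun i => (hpos _ i).le)
      fun i => pow_le_one₀ (hh i).1.le (hh i).2
    have hNj : UniformJet h s N := by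
      refine (UniformJet.primitive hh hNc hNd (fun i => (hM i).neg) ?_ ?_).mono hh (Nat.le_succ s)
      · obtain ⟨C, hC⟩ := hN1
        exact ⟨C, fun i => by simpa using hC i 0 ⟨le_rfl, zero_le_one⟩⟩
      · simpa using hMj.clm (-ContinuousLinearMap.id ℝ (E →L[ℝ] E))
    obtain ⟨C₁, hC₁⟩ := ih (j + 1) (by omega) (M := fun i c => (N i c).comp (A i c))
      (fun i => (hNc i).clm_comp (hA i))
      (hNj.bilin hh (ContinuousLinearMap.compL ℝ E E E) hAj)
      (by
        have := hNb.bilin (ContinuousLinearMap.compL ℝ E E E) (fun i => (hpos _ i).le)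
          (hAj.bound hh)
        simpa using this)
    obtain ⟨C₂, hC₂⟩ := UniformBound.bilin (ContinuousLinearMap.id ℝ (E →L[ℝ] E))
      (fun _ => zero_le_one) hN1 hεb
    obtain ⟨C₃, hC₃⟩ := hNj.integral_legendreProj_sub hNc hg hgj
    refine ⟨B + C₁ + C₂ + max C₃ 0, fun i => ?_⟩
    have hδ : ContinuousOn (fun c => legendreProj s (g i) c - g i c) (Icc 0 1) :=
      (continuous_legendreProj s (g i)).continuousOn.sub (hg i)
    have I0 : IntervalIntegrable (fun c => M i c (w i c)) volume 0 1 :=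
      ((hM i).clm_apply (hw i)).intervalIntegrable_of_Icc zero_le_one
    have I1 : IntervalIntegrable (fun c => (N i c).comp (A i c) (w i c)) volume 0 1 :=
      (((hNc i).clm_comp (hA i)).clm_apply (hw i)).intervalIntegrable_of_Icc zero_le_one
    have I2 : IntervalIntegrable (fun c => N i c (ε i c)) volume 0 1 :=
      ((hNc i).clm_apply (hε i)).intervalIntegrable_of_Icc zero_le_one
    have I3 : IntervalIntegrable (fun c => N i c (legendreProj s (g i) c - g i c)) volume 0 1 :=
      ((hNc i).clm_apply hδ).intervalIntegrable_of_Icc zero_le_one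
    have key := intervalIntegral.integral_eq_sub_of_hasDerivAt_of_le zero_le_one
      ((hNc i).clm_apply (hw i)) (f' := fun c => h i • ((N i c).comp (A i c) (w i c) +
        N i c (ε i c) + N i c (legendreProj s (g i) c - g i c) - M i c (w i c)))
      (fun c hc => by
        refine ((hNd i c hc).clm_apply (hd i c hc)).congr_deriv ?_
        simp only [smul_apply, neg_apply, map_smul, map_add, ContinuousLinearMap.comp_apply,
          ← smul_add]
        congr 1
        abel) ((((I1.add I2).add I3).sub I0).smul (h i))
    have hsum : (∫ c in (0 : ℝ)..1, M i c (w i c)) = (∫ x in (0 : ℝ)..1, M i x) (w i 0) +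
        (∫ c in (0 : ℝ)..1, (N i c).comp (A i c) (w i c)) + (∫ c in (0 : ℝ)..1, N i c (ε i c)) +
        ∫ c in (0 : ℝ)..1, N i c (legendreProj s (g i) c - g i c) := by
      rw [intervalIntegral.integral_smul, intervalIntegral.integral_sub ((I1.add I2).add I3) I0,
        intervalIntegral.integral_add (I1.add I2) I3, intervalIntegral.integral_add I1 I2] at key
      have hN_one : N i 1 = 0 := by simp [hNdef]
      have hN_zero : N i 0 = h i • ∫ x in (0 : ℝ)..1, M i x := rfl
      rw [hN_one, hN_zero, zero_apply, zero_sub, smul_apply, ← smul_neg] at key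
      have := smul_right_injective E (hh i).1.ne' key
      rw [sub_eq_iff_eq_add] at this
      rw [add_assoc, add_assoc, ← add_assoc (∫ _ in (0 : ℝ)..1, _), this]
      abel
    have hb1 : ‖(∫ x in (0 : ℝ)..1, M i x) (w i 0)‖ ≤ B * e i := by
      refine (ContinuousLinearMap.le_opNorm _ _).trans (mul_le_mul ?_ (hw0 i) (norm_nonneg _) hB0)
      exact (hB' i 0 ⟨le_rfl, zero_le_one⟩).trans
        (mul_le_of_le_one_right hB0 (pow_le_one₀ (hh i).1.le (hh i).2))
    have hb2 : ‖∫ c in (0 : ℝ)..1, N i c (ε i c)‖ ≤ C₂ * (e i + h i ^ (2 * s)) :=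
      hint fun c hc => by simpa using hC₂ i c hc
    have hb3 : C₃ * h i ^ (2 * s) ≤ max C₃ 0 * (e i + h i ^ (2 * s)) :=
      mul_le_mul (le_max_left _ _) (le_add_of_nonneg_left (he i)) (hpos _ i).le (le_max_right _ _)
    have hb4 : B * e i ≤ B * (e i + h i ^ (2 * s)) :=
      mul_le_mul_of_nonneg_left (le_add_of_nonneg_right (hpos _ i).le) hB0
    rw [hsum, add_mul, add_mul, add_mul]
    refine norm_add_le_of_le (norm_add_le_of_le (norm_add_le_of_le ?_ (hC₁ i)) hb2) ?_
    · exact hb1.trans hb4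
    · exact (hC₃ i).trans hb3

end

section

universe u

/-- Families of exact and collocation solutions of one step, rescaled to `[0, 1]` and contained in a
fixed ball. The function `u i` solves the equation with memory term `φ i`, and `v i` the truncated
one with memory term `ψ i`. -/
structure StepFamily {ι : Type*} {E : Type u} [NormedAddCommGroup E] [NormedSpace ℝ E]
    (F : E × E → E) (s : ℕ) (R : ℝ) (h : ι → ℝ) (u v : ι → ℝ → E) (φ ψ : ι → E) : Prop where
  step : ∀ i, 0 < h i ∧ h i ≤ 1
  continuousOn_exact : ∀ i, ContinuousOn (u i) (Icc 0 1)
  hasDerivAt_exact : ∀ i, ∀ c ∈ Ioo (0 : ℝ) 1, HasDerivAt (u i) (h i • F (u i c, φ i)) c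
  continuousOn_approx : ∀ i, ContinuousOn (v i) (Icc 0 1)
  hasDerivAt_approx : ∀ i, ∀ c ∈ Ioo (0 : ℝ) 1,
    HasDerivAt (v i) (h i • legendreProj s (fun x => F (v i x, ψ i)) c) c
  exact_le : ∀ i, ∀ c ∈ Icc (0 : ℝ) 1, ‖u i c‖ ≤ R
  approx_le : ∀ i, ∀ c ∈ Icc (0 : ℝ) 1, ‖v i c‖ ≤ R
  memory_exact_le : ∀ i, ‖φ i‖ ≤ R
  memory_approx_le : ∀ i, ‖ψ i‖ ≤ R

variable {ι : Type*} {E : Type u} [NormedAddCommGroup E] [NormedSpace ℝ E]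
  {F : E × E → E} {s : ℕ} {R : ℝ} {h : ι → ℝ} {u v : ι → ℝ → E} {φ ψ : ι → E}

namespace StepFamily

theorem continuousOn_rhs_approx (H : StepFamily F s R h u v φ ψ) (hF : ContDiff ℝ (2 * s : ℕ) F)
    (i : ι) : ContinuousOn (fun c => F (v i c, ψ i)) (Icc 0 1) :=
  hF.continuous.comp_continuousOn ((H.continuousOn_approx i).prodMk continuousOn_const)

variable [FiniteDimensional ℝ E]

theorem jet_exact (H : StepFamily F s R h u v φ ψ) (hF : ContDiff ℝ (2 * s : ℕ) F) :
    UniformJet h s fun i c => F (u i c, φ i) :=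
  UniformJet.bootstrap (r := s) H.step hF H.continuousOn_exact H.hasDerivAt_exact
    (fun i => hF.continuous.comp_continuousOn ((H.continuousOn_exact i).prodMk continuousOn_const))
    H.exact_le H.memory_exact_le (fun _ _ h => h) s (by omega) le_rfl

theorem jet_approx (H : StepFamily F s R h u v φ ψ) (hF : ContDiff ℝ (2 * s : ℕ) F) :
    UniformJet h s fun i c => F (v i c, ψ i) :=
  UniformJet.bootstrap (r := s) H.step hF H.continuousOn_approx H.hasDerivAt_approx
    (fun i => (continuous_legendreProj s _).continuousOn) H.approx_le H.memory_approx_le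
    (fun _ hk hj => hj.legendreProj H.step hk.le (H.continuousOn_rhs_approx hF)) s (by omega) le_rfl

/-- The linearisation of the equation along the exact solutions is an `s`-jet. -/
theorem jet_fderiv (H : StepFamily F s R h u v φ ψ) (hs : 1 ≤ s) (hF : ContDiff ℝ (2 * s : ℕ) F) :
    UniformJet h s fun i c => (fderiv ℝ F (u i c, φ i)).comp (ContinuousLinearMap.inl ℝ E E) :=
  UniformJet.comp_prodMk (k := s) H.step H.continuousOn_exact H.hasDerivAt_exact
    (fun i => hF.continuous.comp_continuousOn ((H.continuousOn_exact i).prodMk continuousOn_const))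
    H.exact_le H.memory_exact_le ((H.jet_exact hF).mono H.step (Nat.sub_le s 1))
    (Φ := fun p => (fderiv ℝ F p).comp (ContinuousLinearMap.inl ℝ E E))
    ((hF.fderiv_right (m := s) (by norm_cast; omega)).clm_comp contDiff_const)

/-- One step amplifies the error data `‖u 0 - v 0‖ + ‖φ - ψ‖` by a bounded factor and adds at most
`O(h ^ (s + 1))`. -/
theorem uniformBound_sub (H : StepFamily F s R h u v φ ψ) (hs : 1 ≤ s)
    (hF : ContDiff ℝ (2 * s : ℕ) F) :
    UniformBound (fun i => (‖v i 0 - u i 0‖ + ‖ψ i - φ i‖) + h i ^ (s + 1))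
      fun i c => v i c - u i c := by
  obtain ⟨L, hL0, hL⟩ := exists_taylor_bound (hF.of_le (by norm_cast; omega)) R
  obtain ⟨D, hD0, hD⟩ := ((H.jet_approx hF).legendreProj_sub
    (H.continuousOn_rhs_approx hF)).exists_nonneg fun i => (pow_pos (H.step i).1 s).le
  refine ⟨Real.exp (L + 1) * (1 + L + D), fun i c hc => ?_⟩
  obtain ⟨h0, h1⟩ := H.step i
  have hgr := norm_le_of_norm_deriv_le (w := fun c => v i c - u i c) (K := L + 1)
    (ε := L * ‖ψ i - φ i‖ + D * h i ^ (s + 1)) (by positivity) (by positivity)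
    ((H.continuousOn_approx i).sub (H.continuousOn_exact i))
    (fun c hc => (H.hasDerivAt_approx i c hc).sub (H.hasDerivAt_exact i c hc))
    (((continuous_legendreProj s _).continuousOn.const_smul (h i)).sub
      ((hF.continuous.comp_continuousOn
        ((H.continuousOn_exact i).prodMk continuousOn_const)).const_smul (h i)))
    (fun c hc => ?_) hc
  · refine hgr.trans ?_
    rw [mul_assoc]
    refine mul_le_mul_of_nonneg_left ?_ (Real.exp_pos _).le
    have h2 : (L * ‖ψ i - φ i‖ + D * h i ^ (s + 1)) / (L + 1) ≤
        L * ‖ψ i - φ i‖ + D * h i ^ (s + 1) :=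
      div_le_self (by positivity) (by linarith)
    have h3 : 0 ≤ h i ^ (s + 1) := by positivity
    have h4 := norm_nonneg (v i 0 - u i 0)
    have h5 := norm_nonneg (ψ i - φ i)
    refine (add_le_add_right h2 _).trans ?_
    nlinarith [mul_nonneg hL0 h3, mul_nonneg hL0 h4, mul_nonneg hD0 h4, mul_nonneg hD0 h5]
  · have e1 := (hL (u i c, φ i) (v i c, ψ i) (max_le (H.exact_le i c hc) (H.memory_exact_le i))
      (max_le (H.approx_le i c hc) (H.memory_approx_le i))).2.1
    have e2 : ‖(v i c, ψ i) - (u i c, φ i)‖ ≤ ‖v i c - u i c‖ + ‖ψ i - φ i‖ :=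
      max_le_add_of_nonneg (norm_nonneg _) (norm_nonneg _)
    have e3 := mul_le_mul_of_nonneg_left e2 hL0
    have e4 := hD i c hc
    rw [← smul_sub, norm_smul, Real.norm_of_nonneg h0.le]
    have e5 : ‖legendreProj s (fun x => F (v i x, ψ i)) c - F (u i c, φ i)‖ ≤
        D * h i ^ s + L * (‖v i c - u i c‖ + ‖ψ i - φ i‖) := by
      rw [← sub_add_sub_cancel _ (F (v i c, ψ i))]
      exact norm_add_le_of_le e4 (e1.trans e3)
    refine (mul_le_mul_of_nonneg_left e5 h0.le).trans ?_
    rw [mul_add, pow_succ]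
    have e6 : h i * (L * (‖v i c - u i c‖ + ‖ψ i - φ i‖)) ≤
        L * (‖v i c - u i c‖ + ‖ψ i - φ i‖) := mul_le_of_le_one_left (by positivity) h1
    nlinarith [norm_nonneg (v i c - u i c)]

/-- Nodal superconvergence: over one step the error changes by at most `h` times the error data,
up to `O(h ^ (2 * s + 1))`. -/
theorem exists_norm_increment_le (H : StepFamily F s R h u v φ ψ) (hs : 1 ≤ s)
    (hF : ContDiff ℝ (2 * s : ℕ) F) :
    ∃ C : ℝ, ∀ i, ‖(v i 1 - u i 1) - (v i 0 - u i 0)‖ ≤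
      C * (h i * (‖v i 0 - u i 0‖ + ‖ψ i - φ i‖ + h i ^ (2 * s))) := by
  obtain ⟨L, hL0, hL⟩ := exists_taylor_bound (hF.of_le (by norm_cast; omega)) R
  have hwb := H.uniformBound_sub hs hF
  set e : ι → ℝ := fun i => ‖v i 0 - u i 0‖ + ‖ψ i - φ i‖ with he_def
  have he : ∀ i, 0 ≤ e i := fun i => by positivity
  have hpos : ∀ n i, 0 < h i ^ n := fun n i => pow_pos (H.step i).1 _
  have he4 : ∀ i, e i ≤ 4 * R := fun i => by
    have h0 : (0 : ℝ) ∈ Icc (0 : ℝ) 1 := ⟨le_rfl, zero_le_one⟩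
    have h1 := norm_sub_le_of_le (H.approx_le i 0 h0) (H.exact_le i 0 h0)
    have h2 := norm_sub_le_of_le (H.memory_approx_le i) (H.memory_exact_le i)
    simp only [he_def]
    linarith
  set A : ι → ℝ → E →L[ℝ] E := fun i c =>
    (fderiv ℝ F (u i c, φ i)).comp (ContinuousLinearMap.inl ℝ E E) with hA_def
  set ε : ι → ℝ → E := fun i c =>
    F (v i c, ψ i) - F (u i c, φ i) - A i c (v i c - u i c) with hε_def
  set g : ι → ℝ → E := fun i c => F (v i c, ψ i) with hg_def
  have hg : ∀ i, ContinuousOn (g i) (Icc 0 1) := H.continuousOn_rhs_approx hF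
  have hgj : UniformJet h s g := H.jet_approx hF
  have hAj : UniformJet h s A := H.jet_fderiv hs hF
  have hu : ∀ i, ContinuousOn (fun c => (u i c, φ i)) (Icc 0 1) := fun i =>
    (H.continuousOn_exact i).prodMk continuousOn_const
  have hA : ∀ i, ContinuousOn (A i) (Icc 0 1) := fun i =>
    ((hF.continuous_fderiv (by norm_cast; omega)).comp_continuousOn (hu i)).clm_comp
      continuousOn_const
  have hw : ∀ i, ContinuousOn (fun c => v i c - u i c) (Icc 0 1) := fun i =>
    (H.continuousOn_approx i).sub (H.continuousOn_exact i)
  have hε : ∀ i, ContinuousOn (ε i) (Icc 0 1) := fun i =>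
    ((hg i).sub (hF.continuous.comp_continuousOn (hu i))).sub ((hA i).clm_apply (hw i))
  have hd : ∀ i, ∀ c ∈ Ioo (0 : ℝ) 1, HasDerivAt (fun c => v i c - u i c)
      (h i • (A i c (v i c - u i c) + ε i c + (legendreProj s (g i) c - g i c))) c := by
    intro i c hc
    refine ((H.hasDerivAt_approx i c hc).sub (H.hasDerivAt_exact i c hc)).congr_deriv ?_
    rw [← smul_sub]
    congr 1
    simp only [hε_def, hg_def]
    abel
  -- The remainder of the linearisation is quadratic in the error, hence harmless.
  have hεb : UniformBound (fun i => e i + h i ^ (2 * s)) ε := by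
    obtain ⟨C, hC0, hC⟩ := hwb.exists_nonneg fun i => add_nonneg (he i) (hpos _ i).le
    refine ⟨L * ((C + 1) ^ 2 * (8 * R + 2)) + L, fun i c hc => ?_⟩
    have hR0 : 0 ≤ R := (norm_nonneg _).trans (H.memory_exact_le i)
    have hΔ : ‖ψ i - φ i‖ ≤ e i := le_add_of_nonneg_left (norm_nonneg _)
    obtain ⟨b1, -, b3⟩ := hL (u i c, φ i) (v i c, ψ i)
      (max_le (H.exact_le i c hc) (H.memory_exact_le i))
      (max_le (H.approx_le i c hc) (H.memory_approx_le i))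
    have hp0 := (hpos (s + 1) i).le
    have b4 : ‖(v i c, ψ i) - (u i c, φ i)‖ ≤ (C + 1) * (e i + h i ^ (s + 1)) := by
      refine max_le ((hC i c hc).trans ?_) (hΔ.trans ?_)
      · exact mul_le_mul_of_nonneg_right (by linarith) (add_nonneg (he i) hp0)
      · nlinarith [he i, mul_nonneg hC0 (he i), mul_nonneg hC0 hp0]
    have b5 : (e i + h i ^ (s + 1)) ^ 2 ≤ (8 * R + 2) * (e i + h i ^ (2 * s)) := by
      have : (h i ^ (s + 1)) ^ 2 ≤ h i ^ (2 * s) := by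
        rw [← pow_mul]
        exact pow_le_pow_of_le_one (H.step i).1.le (H.step i).2 (by omega)
      nlinarith [he i, he4 i, sq_nonneg (e i - h i ^ (s + 1)), mul_nonneg hR0 (hpos (2 * s) i).le,
        mul_nonneg (he i) (sub_nonneg.2 (he4 i))]
    have b6 : ‖(v i c, ψ i) - (u i c, φ i)‖ ^ 2 ≤
        (C + 1) ^ 2 * ((8 * R + 2) * (e i + h i ^ (2 * s))) := by
      refine (pow_le_pow_left₀ (norm_nonneg _) b4 2).trans ?_
      rw [mul_pow]
      exact mul_le_mul_of_nonneg_left b5 (by positivity)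
    have hsplit : ε i c = (F (v i c, ψ i) - F (u i c, φ i) -
        fderiv ℝ F (u i c, φ i) ((v i c, ψ i) - (u i c, φ i))) +
        fderiv ℝ F (u i c, φ i) (0, ψ i - φ i) := by
      have : (v i c, ψ i) - (u i c, φ i) = (v i c - u i c, 0) + (0, ψ i - φ i) := by simp
      rw [this, map_add]
      simp only [hε_def, hA_def, ContinuousLinearMap.comp_apply, ContinuousLinearMap.inl_apply]
      abel
    have b7 : ‖fderiv ℝ F (u i c, φ i) (0, ψ i - φ i)‖ ≤ L * (e i + h i ^ (2 * s)) := by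
      refine (ContinuousLinearMap.le_opNorm _ _).trans (mul_le_mul b1 ?_ (norm_nonneg _) hL0)
      refine max_le (by simpa using add_nonneg (he i) (hpos _ i).le) (hΔ.trans ?_)
      exact le_add_of_nonneg_right (hpos _ i).le
    rw [hsplit, add_mul, mul_assoc, mul_assoc]
    exact norm_add_le_of_le (b3.trans (mul_le_mul_of_nonneg_left b6 hL0)) b7
  have hid := exists_norm_integral_jet_apply_le H.step he hw hd hA hAj hε hεb hg hgj hwb
    (fun i => le_add_of_nonneg_right (norm_nonneg _)) (s - 1) 0 (by omega) hA hAj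
    (by simpa using hAj.bound H.step)
  obtain ⟨C₁, hC₁⟩ := hid
  obtain ⟨C₂, hC₂⟩ := hεb
  refine ⟨C₁ + C₂, fun i => ?_⟩
  have hδ : ContinuousOn (fun c => legendreProj s (g i) c - g i c) (Icc 0 1) :=
    (continuous_legendreProj s (g i)).continuousOn.sub (hg i)
  have I1 : IntervalIntegrable (fun c => A i c (v i c - u i c)) volume 0 1 :=
    ((hA i).clm_apply (hw i)).intervalIntegrable_of_Icc zero_le_one
  have I2 : IntervalIntegrable (ε i) volume 0 1 := (hε i).intervalIntegrable_of_Icc zero_le_one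
  have I3 := hδ.intervalIntegrable_of_Icc (μ := volume) zero_le_one
  have key := intervalIntegral.integral_eq_sub_of_hasDerivAt_of_le zero_le_one (hw i) (hd i)
    (((I1.add I2).add I3).smul (h i))
  have hzero : ∫ c in (0 : ℝ)..1, (legendreProj s (g i) c - g i c) = 0 := by
    simpa using integral_pow_smul_legendreProj_sub s 0 (by omega) (hg i)
  rw [intervalIntegral.integral_smul, intervalIntegral.integral_add (I1.add I2) I3,
    intervalIntegral.integral_add I1 I2, hzero, add_zero] at key
  rw [← key, norm_smul, Real.norm_of_nonneg (H.step i).1.le, mul_left_comm]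
  refine mul_le_mul_of_nonneg_left ?_ (H.step i).1.le
  rw [add_mul]
  refine norm_add_le_of_le (hC₁ i) ?_
  refine (intervalIntegral.norm_integral_le_of_norm_le_const
    (C := C₂ * (e i + h i ^ (2 * s))) fun x hx => ?_).trans (by simp [he_def])
  rw [uIoc_of_le zero_le_one] at hx
  exact hC₂ i x ⟨hx.1.le, hx.2⟩

end StepFamily

end

/-! ### Mesh points and the rescaled step -/

theorem step_pos {ν : ℕ} (hν : 1 ≤ ν) : 0 < step ν := by
  have : (0 : ℝ) < ν := by exact_mod_cast hν
  unfold step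
  positivity

theorem step_le_one {ν : ℕ} (hν : 1 ≤ ν) : step ν ≤ 1 := by
  have : (1 : ℝ) ≤ ν := by exact_mod_cast hν
  exact div_le_self zero_le_one this

theorem mesh_pred_add_step {ν n : ℕ} (hn : 1 ≤ n) : mesh ν (n - 1) + step ν = mesh ν n := by
  obtain ⟨n, rfl⟩ := Nat.exists_eq_add_of_le' hn
  simp [mesh, step, add_div]

theorem mesh_mul {ν : ℕ} (hν : 1 ≤ ν) (k : ℕ) : mesh ν (k * ν) = k := by
  have : (0 : ℝ) < ν := by exact_mod_cast hν
  simp [mesh, this.ne']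

theorem le_mesh_pred {ν : ℕ} (hν : 1 ≤ ν) (n : ℕ) :
    (((n - 1) / ν : ℕ) : ℝ) ≤ mesh ν (n - 1) := by
  have : (0 : ℝ) < ν := by exact_mod_cast hν
  rw [mesh, le_div_iff₀ this]
  exact_mod_cast Nat.div_mul_le_self (n - 1) ν

theorem mesh_le {ν n : ℕ} (hν : 1 ≤ ν) (hn : 1 ≤ n) :
    mesh ν n ≤ (((n - 1) / ν : ℕ) : ℝ) + 1 := by
  have : (0 : ℝ) < ν := by exact_mod_cast hν
  rw [mesh, div_le_iff₀ this]
  have h := Nat.lt_div_mul_add (a := n - 1) hν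
  have : n ≤ ((n - 1) / ν + 1) * ν := by rw [add_mul, one_mul]; omega
  exact_mod_cast this

theorem floor_eq {ν n : ℕ} (hν : 1 ≤ ν) (hn : 1 ≤ n) {c : ℝ} (hc : c ∈ Ico (0 : ℝ) 1) :
    ⌊mesh ν (n - 1) + c * step ν⌋ = (((n - 1) / ν : ℕ) : ℤ) := by
  have h0 := step_pos hν
  have h1 := le_mesh_pred hν n
  have h2 := mesh_le hν hn
  rw [← mesh_pred_add_step hn] at h2
  have h3 := mul_nonneg hc.1 h0.le
  have h4 := mul_lt_mul_of_pos_right hc.2 h0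
  rw [Int.floor_eq_iff, Int.cast_natCast]
  constructor <;> linarith

variable {m s K ν n : ℕ} {f : Vec m → Vec m → Vec m} {y₀ : Vec m} {y σ : ℝ → Vec m} {ρ : ℝ}

theorem continuousOn_exact_step (hy : IsSolution f y₀ K y) (hν : 1 ≤ ν) (hn : 1 ≤ n)
    (hnK : n ≤ K * ν) :
    ContinuousOn (fun c => y (mesh ν (n - 1) + c * step ν)) (Icc 0 1) := by
  refine hy.continuousOn.comp (Continuous.continuousOn (by fun_prop)) fun c hc => ?_
  have h0 := step_pos hν
  have h1 := le_mesh_pred hν n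
  have h2 : mesh ν n ≤ K := by
    have : (0 : ℝ) < ν := by exact_mod_cast hν
    rw [mesh, div_le_iff₀ this]
    exact_mod_cast hnK
  rw [← mesh_pred_add_step hn] at h2
  have h3 := mul_nonneg hc.1 h0.le
  have h4 := mul_le_mul_of_nonneg_right hc.2 h0.le
  have h5 : (0 : ℝ) ≤ (((n - 1) / ν : ℕ) : ℝ) := Nat.cast_nonneg _
  constructor <;> linarith

theorem hasDerivAt_exact_step (hy : IsSolution f y₀ K y) (hν : 1 ≤ ν) (hn : 1 ≤ n)
    (hnK : n ≤ K * ν) {c : ℝ} (hc : c ∈ Ioo (0 : ℝ) 1) :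
    HasDerivAt (fun c => y (mesh ν (n - 1) + c * step ν))
      (step ν • f (y (mesh ν (n - 1) + c * step ν)) (y (⌊mesh ν (n - 1)⌋ : ℝ))) c := by
  have hfl := floor_eq hν hn (c := c) ⟨hc.1.le, hc.2⟩
  have hfl0 := floor_eq hν hn (c := 0) ⟨le_rfl, zero_lt_one⟩
  rw [zero_mul, add_zero] at hfl0
  have hk : (n - 1) / ν < K := (Nat.div_lt_iff_lt_mul hν).2 (by omega)
  have h0 := step_pos hν
  have h1 := le_mesh_pred hν n
  have h2 := mesh_le hν hn
  rw [← mesh_pred_add_step hn] at h2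
  have h3 := mul_pos hc.1 h0
  have h4 := mul_lt_mul_of_pos_right hc.2 h0
  have heq := hy.equation _ hk (mesh ν (n - 1) + c * step ν) ⟨by linarith, by linarith⟩
  rw [hfl] at heq
  rw [hfl0]
  have hd := heq.hasDerivAt (Ico_mem_nhds (by linarith) (by linarith))
  have hlin : HasDerivAt (fun c => mesh ν (n - 1) + c * step ν) (step ν) c := by
    simpa using ((hasDerivAt_id' c).mul_const (step ν)).const_add (mesh ν (n - 1))
  exact hd.scomp c hlin

theorem IsPolyApprox.continuousOn_step (hσ : IsPolyApprox f y₀ s K ν σ) (hn : 1 ≤ n)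
    (hnK : n ≤ K * ν) : ContinuousOn (fun c => piece ν σ n (c * step ν)) (Icc 0 1) := by
  obtain ⟨a, ha⟩ := hσ.polynomial n hn hnK
  exact ContinuousOn.congr (Continuous.continuousOn (by fun_prop)) ha

theorem IsPolyApprox.hasDerivAt_step (hσ : IsPolyApprox f y₀ s K ν σ) (hν : 1 ≤ ν) (hn : 1 ≤ n)
    (hnK : n ≤ K * ν) {c : ℝ} (hc : c ∈ Ioo (0 : ℝ) 1) :
    HasDerivAt (fun c => piece ν σ n (c * step ν))
      (step ν • legendreProj s
        (fun x => f (piece ν σ n (x * step ν)) (σ (⌊mesh ν (n - 1)⌋ : ℝ))) c) c := by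
  have h0 := step_pos hν
  have hd := (hσ.equation n hn hnK c ⟨hc.1.le, hc.2.le⟩).hasDerivAt
    (Icc_mem_nhds (mul_pos hc.1 h0) (mul_lt_of_lt_one_left h0 hc.2))
  have hlin : HasDerivAt (fun c => c * step ν) (step ν) c := by
    simpa using (hasDerivAt_id' c).mul_const (step ν)
  exact HasDerivAt.scomp (g₁ := piece ν σ n) c hd hlin

theorem IsSolution.exists_norm_le (hy : IsSolution f y₀ K y) :
    ∃ B : ℝ, 0 ≤ B ∧ ∀ t ∈ Icc (0 : ℝ) K, ‖y t‖ ≤ B := by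
  obtain ⟨B, hB⟩ := isCompact_Icc.exists_bound_of_continuousOn hy.continuousOn
  exact ⟨max B 0, le_max_right _ _, fun t ht => (hB t ht).trans (le_max_left _ _)⟩

theorem mesh_mem_Icc (hν : 1 ≤ ν) (hnK : n ≤ K * ν) : mesh ν n ∈ Icc (0 : ℝ) K := by
  have : (0 : ℝ) < ν := by exact_mod_cast hν
  refine ⟨by unfold mesh; positivity, ?_⟩
  rw [mesh, div_le_iff₀ this]
  exact_mod_cast hnK

/-- The grid index of the point at which the memory term of the `n`-th step is evaluated. -/
def memIndex (ν n : ℕ) : ℕ := (n - 1) / ν * ν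

theorem memIndex_le (ν n : ℕ) : memIndex ν n ≤ n - 1 := Nat.div_mul_le_self _ _

theorem floor_mesh_eq (hν : 1 ≤ ν) (hn : 1 ≤ n) :
    ((⌊mesh ν (n - 1)⌋ : ℤ) : ℝ) = mesh ν (memIndex ν n) := by
  have hfl := floor_eq hν hn (c := 0) ⟨le_rfl, zero_lt_one⟩
  rw [zero_mul, add_zero] at hfl
  rw [hfl, memIndex, mesh_mul hν, Int.cast_natCast]

/-- The global error at the mesh points. -/
noncomputable def nodalError {m : ℕ} (y σ : ℝ → Vec m) (ν n : ℕ) : Vec m :=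
  y (mesh ν n) - σ (mesh ν n)

/-- The one step estimates, uniformly over all approximations which lie in the ball of radius `B` at
the beginning of the step and at the point of the memory term. -/
theorem exists_local_bound (hs : 1 ≤ s)
    (hf : ContDiff ℝ (2 * s : ℕ) (fun p : Vec m × Vec m => f p.1 p.2))
    (hy : IsSolution f y₀ K y) (ρ B : ℝ) :
    ∃ C : ℝ, 0 ≤ C ∧ ∀ (ν : ℕ) (σ : ℝ → Vec m) (n : ℕ), 1 ≤ ν → IsPolyApprox f y₀ s K ν σ →
      StepBounded ρ K ν σ → 1 ≤ n → n ≤ K * ν → ‖σ (mesh ν (n - 1))‖ ≤ B →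
      ‖σ (mesh ν (memIndex ν n))‖ ≤ B →
      ‖nodalError y σ ν n - nodalError y σ ν (n - 1)‖ ≤
        C * (step ν * (‖nodalError y σ ν (n - 1)‖ + ‖nodalError y σ ν (memIndex ν n)‖ +
          step ν ^ (2 * s))) ∧
      ∀ c ∈ Icc (0 : ℝ) 1,
        ‖y (mesh ν (n - 1) + c * step ν) - σ (mesh ν (n - 1) + c * step ν)‖ ≤
          C * (‖nodalError y σ ν (n - 1)‖ + ‖nodalError y σ ν (memIndex ν n)‖ +
            step ν ^ (s + 1)) := by
  obtain ⟨B', hB'0, hB'⟩ := hy.exists_norm_le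
  let ι := {q : ℕ × (ℝ → Vec m) × ℕ // 1 ≤ q.1 ∧ IsPolyApprox f y₀ s K q.1 q.2.1 ∧
    StepBounded ρ K q.1 q.2.1 ∧ 1 ≤ q.2.2 ∧ q.2.2 ≤ K * q.1 ∧
    ‖q.2.1 (mesh q.1 (q.2.2 - 1))‖ ≤ B ∧ ‖q.2.1 (mesh q.1 (memIndex q.1 q.2.2))‖ ≤ B}
  have H : StepFamily (ι := ι) (fun p : Vec m × Vec m => f p.1 p.2) s (max B' (B + |ρ|))
      (fun q => step q.1.1)
      (fun q c => y (mesh q.1.1 (q.1.2.2 - 1) + c * step q.1.1))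
      (fun q c => piece q.1.1 q.1.2.1 q.1.2.2 (c * step q.1.1))
      (fun q => y (⌊mesh q.1.1 (q.1.2.2 - 1)⌋ : ℝ))
      (fun q => q.1.2.1 (⌊mesh q.1.1 (q.1.2.2 - 1)⌋ : ℝ)) := by
    constructor
    · rintro ⟨⟨ν, σ, n⟩, hν, hσ, hρ, hn, hnK, h1, h2⟩
      exact ⟨step_pos hν, step_le_one hν⟩
    · rintro ⟨⟨ν, σ, n⟩, hν, hσ, hρ, hn, hnK, h1, h2⟩
      exact continuousOn_exact_step hy hν hn hnK
    · rintro ⟨⟨ν, σ, n⟩, hν, hσ, hρ, hn, hnK, h1, h2⟩ c hc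
      exact hasDerivAt_exact_step hy hν hn hnK hc
    · rintro ⟨⟨ν, σ, n⟩, hν, hσ, hρ, hn, hnK, h1, h2⟩
      exact hσ.continuousOn_step hn hnK
    · rintro ⟨⟨ν, σ, n⟩, hν, hσ, hρ, hn, hnK, h1, h2⟩ c hc
      exact hσ.hasDerivAt_step hν hn hnK hc
    · rintro ⟨⟨ν, σ, n⟩, hν, hσ, hρ, hn, hnK, h1, h2⟩ c hc
      refine (hB' _ ?_).trans (le_max_left _ _)
      have h0 := step_pos hν
      have h3 := (mesh_mem_Icc (n := n - 1) (K := K) hν ((Nat.sub_le n 1).trans hnK)).1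
      have h4 := (mesh_mem_Icc hν hnK).2
      rw [← mesh_pred_add_step hn] at h4
      have h5 := mul_nonneg hc.1 h0.le
      have h6 := mul_le_mul_of_nonneg_right hc.2 h0.le
      constructor <;> linarith
    · rintro ⟨⟨ν, σ, n⟩, hν, hσ, hρ, hn, hnK, h1, h2⟩ c hc
      refine le_trans ?_ (le_max_right _ _)
      have h3 := hρ n hn hnK c hc
      have h4 : piece ν σ n 0 = σ (mesh ν (n - 1)) := by simp [piece]
      rw [h4] at h3
      have h5 := norm_add_le_of_le (h3.trans (le_abs_self ρ)) h1
      rw [sub_add_cancel] at h5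
      exact h5.trans (le_of_eq (add_comm _ _))
    · rintro ⟨⟨ν, σ, n⟩, hν, hσ, hρ, hn, hnK, h1, h2⟩
      simp only [floor_mesh_eq hν hn]
      have hκ := (memIndex_le ν n).trans (Nat.sub_le n 1)
      exact (hB' _ (mesh_mem_Icc hν (hκ.trans hnK))).trans (le_max_left _ _)
    · rintro ⟨⟨ν, σ, n⟩, hν, hσ, hρ, hn, hnK, h1, h2⟩
      simp only [floor_mesh_eq hν hn]
      exact (h2.trans (le_add_of_nonneg_right (abs_nonneg ρ))).trans (le_max_right _ _)
  obtain ⟨C₁, hC₁⟩ := H.exists_norm_increment_le hs hf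
  obtain ⟨C₂, hC₂⟩ := H.uniformBound_sub hs hf
  refine ⟨max (max C₁ C₂) 0, le_max_right _ _, fun ν σ n hν hσ hρ hn hnK h1 h2 => ?_⟩
  have h0 := step_pos hν
  have e1 := hC₁ ⟨⟨ν, σ, n⟩, hν, hσ, hρ, hn, hnK, h1, h2⟩
  have e2 := hC₂ ⟨⟨ν, σ, n⟩, hν, hσ, hρ, hn, hnK, h1, h2⟩
  simp only [piece, floor_mesh_eq hν hn, one_mul, zero_mul, add_zero, mesh_pred_add_step hn]
    at e1 e2
  constructor
  · rw [norm_sub_rev (σ (mesh ν (n - 1))), norm_sub_rev (σ (mesh ν (memIndex ν n)))] at e1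
    rw [nodalError, nodalError, nodalError, ← norm_neg,
      show -(y (mesh ν n) - σ (mesh ν n) - (y (mesh ν (n - 1)) - σ (mesh ν (n - 1)))) =
        σ (mesh ν n) - y (mesh ν n) - (σ (mesh ν (n - 1)) - y (mesh ν (n - 1))) by abel]
    refine e1.trans (mul_le_mul_of_nonneg_right ?_ (by positivity))
    exact (le_max_left _ _).trans (le_max_left _ _)
  · intro c hc
    have e3 := e2 c hc
    rw [norm_sub_rev (σ (mesh ν (n - 1))), norm_sub_rev (σ (mesh ν (memIndex ν n))),
      norm_sub_rev (σ _) (y _)] at e3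
    refine e3.trans (mul_le_mul_of_nonneg_right ?_ (by positivity))
    exact (le_max_right _ _).trans (le_max_left _ _)

/-! ### Accumulation of the local errors -/

/-- A discrete Grönwall inequality with memory. The local estimate is only required as long as the
sequence stays below `M`, and the conclusion keeps it there. -/
theorem discrete_gronwall {E : Type*} [NormedAddCommGroup E] {e : ℕ → E} {N : ℕ} {κ : ℕ → ℕ}
    {C h η M : ℝ} (hC : 0 ≤ C) (hh : 0 ≤ h) (hη : 0 ≤ η) (h0 : e 0 = 0)
    (hκ : ∀ n, 1 ≤ n → κ n ≤ n - 1)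
    (hstep : ∀ n, 1 ≤ n → n ≤ N → ‖e (n - 1)‖ ≤ M → ‖e (κ n)‖ ≤ M →
      ‖e n - e (n - 1)‖ ≤ C * (h * (‖e (n - 1)‖ + ‖e (κ n)‖ + η)))
    (hM : N * h * C * Real.exp (2 * C * (N * h)) * η ≤ M) :
    ∀ n ≤ N, ‖e n‖ ≤ N * h * C * Real.exp (2 * C * (N * h)) * η := by
  set q : ℝ := 1 + 2 * C * h with hq
  have hCh : 0 ≤ C * h := mul_nonneg hC hh
  have hq1 : 1 ≤ q := by rw [hq]; nlinarith
  have hb : ∀ n : ℕ, n ≤ N → n * (C * h * η) * q ^ n ≤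
      N * h * C * Real.exp (2 * C * (N * h)) * η := by
    intro n hn
    have hn' : (n : ℝ) ≤ N := by exact_mod_cast hn
    have h1 : q ^ n ≤ Real.exp (2 * C * (N * h)) := by
      have h2 : q ≤ Real.exp (2 * C * h) := by
        rw [hq, add_comm]
        exact Real.add_one_le_exp _
      refine (pow_le_pow_left₀ (by linarith) h2 n).trans ?_
      rw [← Real.exp_nat_mul]
      refine Real.exp_le_exp.2 ?_
      nlinarith [mul_le_mul_of_nonneg_right hn' hCh]
    calc n * (C * h * η) * q ^ n ≤ N * (C * h * η) * Real.exp (2 * C * (N * h)) := by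
          gcongr
      _ = _ := by ring
  have hmono : ∀ j n : ℕ, j ≤ n → j * (C * h * η) * q ^ j ≤ n * (C * h * η) * q ^ n := by
    intro j n hjn
    have hjn' : (j : ℝ) ≤ n := by exact_mod_cast hjn
    gcongr
  have hmain : ∀ n ≤ N, ‖e n‖ ≤ n * (C * h * η) * q ^ n := by
    intro n
    induction n using Nat.strong_induction_on with
    | _ n ih =>
      intro hn
      rcases Nat.eq_zero_or_pos n with rfl | hpos
      · simp [h0]
      · have hk := hκ n hpos
        have i1 := ih (n - 1) (by omega) (by omega)
        have i2 := (ih (κ n) (by omega) (by omega)).trans (hmono _ _ hk)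
        have hs := hstep n hpos hn (i1.trans ((hb _ (by omega)).trans hM))
          (i2.trans ((hb _ (by omega)).trans hM))
        set b := ((n - 1 : ℕ) : ℝ) * (C * h * η) * q ^ (n - 1) with hbdef
        have h3 : ‖e n‖ ≤ b + C * (h * (b + b + η)) := by
          have h4 := norm_add_le (e n - e (n - 1)) (e (n - 1))
          rw [sub_add_cancel] at h4
          have h5 : C * (h * (‖e (n - 1)‖ + ‖e (κ n)‖ + η)) ≤ C * (h * (b + b + η)) := by
            gcongr
          linarith
        refine h3.trans ?_
        have h6 : b + C * (h * (b + b + η)) = b * q + C * h * η := by rw [hq]; ring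
        have h7 : (n : ℝ) * (C * h * η) * q ^ n = b * q + C * h * η * q ^ n := by
          obtain ⟨n, rfl⟩ := Nat.exists_eq_add_of_le' hpos
          rw [hbdef, Nat.add_sub_cancel]
          push_cast
          ring
        rw [h6, h7]
        have h8 : 0 ≤ C * h * η := mul_nonneg hCh hη
        have := le_mul_of_one_le_right h8 (one_le_pow₀ hq1 (n := n))
        linarith
  exact fun n hn => (hmain n hn).trans (hb n hn)

theorem mul_step_eq (hν : 1 ≤ ν) : ((K * ν : ℕ) : ℝ) * step ν = K := by
  have : (0 : ℝ) < ν := by exact_mod_cast hν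
  rw [step]
  push_cast
  field_simp

theorem nodalError_zero (hy : IsSolution f y₀ K y) (hσ : IsPolyApprox f y₀ s K ν σ) :
    nodalError y σ ν 0 = 0 := by
  simp [nodalError, mesh, hy.initial, hσ.initial]

/-- Moving at most `ρ` in each step, an approximation is bounded in terms of the number of steps. -/
theorem norm_le_of_stepBounded (hσ : IsPolyApprox f y₀ s K ν σ) (hρ : StepBounded ρ K ν σ)
    (hnK : n ≤ K * ν) : ‖σ (mesh ν n)‖ ≤ ‖y₀‖ + n * |ρ| := by
  induction n with
  | zero => simp [mesh, hσ.initial]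
  | succ n ih =>
    have h := hρ (n + 1) (by omega) hnK 1 ⟨zero_le_one, le_rfl⟩
    simp only [piece, one_mul, mesh_pred_add_step (ν := ν) (n := n + 1) (by omega), add_zero] at h
    have h2 := norm_add_le_of_le (h.trans (le_abs_self ρ)) (ih (by omega))
    rw [Nat.add_sub_cancel, sub_add_cancel] at h2
    push_cast
    linarith

/-- All approximations lie in a common ball at the mesh points: for small steps because the error
stays below `1`, and for the finitely many other step sizes because the number of steps is
bounded. -/
theorem exists_norm_approx_le (hs : 1 ≤ s)
    (hf : ContDiff ℝ (2 * s : ℕ) (fun p : Vec m × Vec m => f p.1 p.2))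
    (hy : IsSolution f y₀ K y) (ρ : ℝ) :
    ∃ B : ℝ, ∀ (ν : ℕ) (σ : ℝ → Vec m), 1 ≤ ν → IsPolyApprox f y₀ s K ν σ →
      StepBounded ρ K ν σ → ∀ n ≤ K * ν, ‖σ (mesh ν n)‖ ≤ B := by
  obtain ⟨B, hB0, hB⟩ := hy.exists_norm_le
  obtain ⟨C, hC0, hC⟩ := exists_local_bound hs hf hy ρ (B + 1)
  -- For `D ≤ ν` the bound `D * h ^ (2 * s)` of `discrete_gronwall` is at most `1`.
  set D : ℝ := K * C * Real.exp (2 * C * K) with hD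
  have hD0 : 0 ≤ D := by positivity
  refine ⟨max (B + 1) (‖y₀‖ + K * D * |ρ|), fun ν σ hν hσ hρ n hn => ?_⟩
  have hν' : (0 : ℝ) < ν := by exact_mod_cast hν
  have hle : ∀ j ≤ K * ν, ‖nodalError y σ ν j‖ ≤ 1 → ‖σ (mesh ν j)‖ ≤ B + 1 := by
    intro j hj h1
    have := norm_sub_le_of_le (hB _ (mesh_mem_Icc hν hj)) h1
    rwa [nodalError, sub_sub_cancel] at this
  by_cases hDν : D ≤ ν
  · refine le_trans (hle n hn ?_) (le_max_left _ _)
    have hsmall : D * step ν ^ (2 * s) ≤ 1 := by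
      have h1 : step ν ^ (2 * s) ≤ step ν :=
        pow_le_of_le_one (step_pos hν).le (step_le_one hν) (by omega)
      refine (mul_le_mul_of_nonneg_left h1 hD0).trans ?_
      rw [step, mul_one_div]
      exact (div_le_one hν').2 hDν
    have key := discrete_gronwall (e := nodalError y σ ν) (N := K * ν) (κ := memIndex ν) (M := 1)
      hC0 (step_pos hν).le (pow_nonneg (step_pos hν).le (2 * s)) (nodalError_zero hy hσ)
      (fun n _ => memIndex_le ν n) (fun n h1 h2 h3 h4 => (hC ν σ n hν hσ hρ h1 h2
        (hle _ (by omega) h3) (hle _ (by have := memIndex_le ν n; omega) h4)).1)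
      (by rwa [mul_step_eq hν])
    rw [mul_step_eq hν] at key
    exact (key n hn).trans hsmall
  · refine (norm_le_of_stepBounded hσ hρ hn).trans (le_trans ?_ (le_max_right _ _))
    have h1 : (n : ℝ) ≤ K * ν := by exact_mod_cast hn
    have h2 : (K : ℝ) * ν ≤ K * D :=
      mul_le_mul_of_nonneg_left (not_le.1 hDν).le (Nat.cast_nonneg K)
    gcongr
    exact h1.trans h2

end FDEPCA

theorem mainTheorem2 (m s K : ℕ) (hs : 1 ≤ s)
    (f : FDEPCA.Vec m → FDEPCA.Vec m → FDEPCA.Vec m)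
    (hf : ContDiff ℝ (2 * s : ℕ) (fun p : FDEPCA.Vec m × FDEPCA.Vec m => f p.1 p.2))
    (y₀ : FDEPCA.Vec m) (y : ℝ → FDEPCA.Vec m) (hy : FDEPCA.IsSolution f y₀ K y) (ρ : ℝ) :
    ∃ C : ℝ, ∀ ν : ℕ, 1 ≤ ν → ∀ σ : ℝ → FDEPCA.Vec m,
      FDEPCA.IsPolyApprox f y₀ s K ν σ → FDEPCA.StepBounded ρ K ν σ →
      ∀ n : ℕ, 1 ≤ n → n ≤ K * ν →
        ‖(y (FDEPCA.mesh ν n) - σ (FDEPCA.mesh ν n)) -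
            (y (FDEPCA.mesh ν (n - 1)) - σ (FDEPCA.mesh ν (n - 1)))‖
          ≤ C * FDEPCA.step ν ^ (2 * s + 1) ∧
        ∀ c ∈ Set.Ioo (0 : ℝ) 1,
          ‖y (FDEPCA.mesh ν (n - 1) + c * FDEPCA.step ν) -
              σ (FDEPCA.mesh ν (n - 1) + c * FDEPCA.step ν)‖
            ≤ C * FDEPCA.step ν ^ (s + 1) := by
  obtain ⟨B, hB⟩ := FDEPCA.exists_norm_approx_le hs hf hy ρ
  obtain ⟨C, hC0, hC⟩ := FDEPCA.exists_local_bound hs hf hy ρ B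
  -- Both error terms in the one step estimates are at most `D * h ^ (2 * s)`.
  set D : ℝ := K * C * Real.exp (2 * C * K) with hD
  have hD0 : 0 ≤ D := by positivity
  refine ⟨C * (D + D + 1), fun ν hν σ hσ hρ n hn hnK => ?_⟩
  have h0 := FDEPCA.step_pos hν
  have hmem : ∀ n, 1 ≤ n → n ≤ K * ν → FDEPCA.memIndex ν n ≤ K * ν := fun n _ _ => by
    have := FDEPCA.memIndex_le ν n
    omega
  have hloc := fun n hn hnK => hC ν σ n hν hσ hρ hn hnK (hB ν σ hν hσ hρ _ (by omega))
    (hB ν σ hν hσ hρ _ (hmem n hn hnK))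
  have herr := FDEPCA.discrete_gronwall (e := FDEPCA.nodalError y σ ν) (N := K * ν)
    (κ := FDEPCA.memIndex ν) hC0 h0.le (pow_nonneg h0.le (2 * s)) (FDEPCA.nodalError_zero hy hσ)
    (fun n _ => FDEPCA.memIndex_le ν n) (fun n h1 h2 _ _ => (hloc n h1 h2).1) le_rfl
  rw [FDEPCA.mul_step_eq hν] at herr
  have e1 := herr (n - 1) (by omega)
  have e2 := herr _ (hmem n hn hnK)
  obtain ⟨l1, l2⟩ := hloc n hn hnK
  constructor
  · refine l1.trans ?_
    rw [pow_succ, mul_assoc C]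
    refine mul_le_mul_of_nonneg_left ?_ hC0
    rw [← mul_assoc, mul_comm (_ * _) (FDEPCA.step ν)]
    refine mul_le_mul_of_nonneg_left ?_ h0.le
    linarith
  · intro c hc
    refine (l2 c ⟨hc.1.le, hc.2.le⟩).trans ?_
    have h3 : FDEPCA.step ν ^ (2 * s) ≤ FDEPCA.step ν ^ (s + 1) :=
      pow_le_pow_of_le_one h0.le (FDEPCA.step_le_one hν) (by omega)
    have h4 := mul_le_mul_of_nonneg_left h3 hD0
    rw [mul_assoc]
    refine mul_le_mul_of_nonneg_left ?_ hC0
    linarith
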